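/- Consider a continuous-time level-dependent QBD process, i.e. a continuous-time Markov chain whose (conservative) infinitesimal generator is $$Q=\begin{pmatrix}A_1^{(0)}&A_0^{(0)}&&&\\A_2^{(1)}&A_1^{(1)}&A_0^{(1)}&&\\&A_2^{(2)}&A_1^{(2)}&A_0^{(2)}&\\&&\ddots&\ddots&\ddots\end{pmatrix},$$ where $A_1^{(0)}$ has size $m_0\ge1$ and $A_1^{(k)}$ has size $m$ for $k\ge1$. Assume that the chain is irreducible and positive recurrent, let $x=(x_0,x_1,x_2,\dots)$ be its stationary probability vector ($x\ge0$, $xe=1$, $xQ=0$), and let $\pi=(\pi_1,\pi_2,\dots)$ with $\pi_k=\sum_{j\ge k}x_j$. Put $$\widehat Q=\begin{pmatrix}A_1^{(1)}&A_0^{(1)}&&\\A_2^{(2)}&A_1^{(2)}&A_0^{(2)}&\\&\ddots&\ddots&\ddots\end{pmatrix},\qquad \mathbb Q=\begin{pmatrix}\mathbf 0\\ \widehat Q\end{pmatrix},$$ where $\mathbf 0$ is one zero block row. Put $\Psi_0=A_1^{(1)}$ and, for $k\ge1$, $\Psi_k=A_1^{(k+1)}+A_2^{(k+1)}(-\Psi_{k-1}^{-1})A_0^{(k)}$,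 $\mathbf R_k=A_2^{(k+1)}(-\Psi_{k-1}^{-1})$ and $\mathbf G_{k-1}=(-\Psi_{k-1}^{-1})A_0^{(k)}$. Let $\mathbb R_L$ have the blocks $\mathbf R_1,\mathbf R_2,\dots$ directly below the block diagonal, let $\mathbb G_U$ have the blocks $\mathbf G_0,\mathbf G_1,\dots$ directly above it (all other blocks being $0$), and let $\mathbb U_D=\mathrm{diag}(\Psi_0,\Psi_1,\dots)$. Then, all products and sums of infinite matrices below converging entrywise: 1. $\pi(\widehat Q-\mathbb Q)=-(x_0A_0^{(0)},0,0,\dots)$. 2. Each $\Psi_l$, $l\ge0$, has nonnegative off-diagonal entries and nonpositive row sums, is invertible, and satisfies $-\Psi_l^{-1}\ge0$. The sequence $\{\mathbf R_k\}_{k\ge1}$ is the unique nonnegative solution of $\mathbf R_{k+1}\mathbf R_kA_0^{(k)}+\mathbf R_{k+1}A_1^{(k+1)}+A_2^{(k+2)}=0$ ($k\ge1$) with $\mathbf R_1=A_2^{(2)}(-\Psi_0^{-1})$, and $\{\mathbf G_k\}_{k\ge0}$ is the unique nonnegative solution of $A_0^{(k+1)}+A_1^{(k+1)}\mathbf G_k+A_2^{(k+1)}\mathbf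 G_{k-1}\mathbf G_k=0$ ($k\ge1$) with $\mathbf G_0=(-\Psi_0^{-1})A_0^{(1)}$. For $k\ge1$ they satisfy the recursions (with invertible brackets) $\mathbf R_{k+1}=-A_2^{(k+2)}[\mathbf R_kA_0^{(k)}+A_1^{(k+1)}]^{-1}$ and $\mathbf G_k=-[A_1^{(k+1)}+A_2^{(k+1)}\mathbf G_{k-1}]^{-1}A_0^{(k+1)}$. 3. $\widehat Q=(I-\mathbb R_L)\,\mathbb U_D\,(I-\mathbb G_U)$. The three factors have the two-sided inverses $(I-\mathbb R_L)^{-1}$, block lower triangular with identity diagonal blocks and $(l,l-k)$ block $X_k^{(l)}=\mathbf R_l\mathbf R_{l-1}\cdots\mathbf R_{l-k+1}$ ($l\ge k\ge1$); $\mathbb U_D^{-1}=\mathrm{diag}(\Psi_0^{-1},\Psi_1^{-1},\dots)$; and $(I-\mathbb G_U)^{-1}$, block upper triangular with identity diagonal blocks and $(l,l+k)$ block $Y_k^{(l)}=\mathbf G_l\mathbf G_{l+1}\cdots\mathbf G_{l+k-1}$ ($k\ge1$, $l\ge0$), where block rows and columns are numbered from $0$. 4. $\widehat Q$ has a maximal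 non-positive inverse $\widehat Q_{\max}^{-1}$ (the entrywise greatest among its two-sided inverses with non-positive entries), and $$\widehat Q_{\max}^{-1}=(I-\mathbb G_U)^{-1}\,\mathbb U_D^{-1}\,(I-\mathbb R_L)^{-1}.$$ 5. $\pi\bigl(I-\mathbb Q\widehat Q_{\max}^{-1}\bigr)=-(x_0A_0^{(0)},0,0,\dots)\widehat Q_{\max}^{-1}$, and $$\pi=-(x_0A_0^{(0)},0,0,\dots)\,\widehat Q_{\max}^{-1}\sum_{k=0}^{\infty}\bigl(\mathbb Q\widehat Q_{\max}^{-1}\bigr)^k .$$ -/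

import Mathlib

open scoped ENNReal

noncomputable section

/-! ### Infinite matrices and row vectors

A product of infinite matrices is an entrywise (unconditionally convergent) series, so it is a
relation: it holds only if all the series converge. -/

/-- `A B = C` for possibly infinite matrices: every entry of the product converges. -/
def HasMatMul {I J K : Type*} (A : Matrix I J ℝ) (B : Matrix J K ℝ) (C : Matrix I K ℝ) : Prop :=
  ∀ i k, HasSum (fun j => A i j * B j k) (C i k)

/-- `(A B) C = D`. -/
def HasMatMul₃ {I J K L : Type*} (A : Matrix I J ℝ) (B : Matrix J K ℝ) (C : Matrix K L ℝ)
    (D : Matrix I L ℝ) : Prop :=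
  ∃ T : Matrix I K ℝ, HasMatMul A B T ∧ HasMatMul T C D

/-- `v M = w` for row vectors `v`, `w`. -/
def HasVecMul {I J : Type*} (v : I → ℝ) (M : Matrix I J ℝ) (w : J → ℝ) : Prop :=
  ∀ j, HasSum (fun i => v i * M i j) (w j)

/-- `W` is a two-sided inverse of `M`. -/
def IsMatInverse {I : Type*} [DecidableEq I] (M W : Matrix I I ℝ) : Prop :=
  HasMatMul M W 1 ∧ HasMatMul W M 1

/-- `V` is the maximal non-positive inverse of `M`: the entrywise greatest one among the
inverses of `M` with non-positive entries. -/
def IsMaxNonposInverse {I : Type*} [DecidableEq I] (M V : Matrix I I ℝ) : Prop :=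
  IsMatInverse M V ∧ (∀ i j, V i j ≤ 0) ∧
    ∀ W : Matrix I I ℝ, IsMatInverse M W → (∀ i j, W i j ≤ 0) → ∀ i j, W i j ≤ V i j

/-- `S = ∑_{k ≥ 0} W ^ k`, with every power `P k = W ^ k` and the sum converging entrywise. -/
def HasPowerSum {I : Type*} [DecidableEq I] (W S : Matrix I I ℝ) : Prop :=
  ∃ P : ℕ → Matrix I I ℝ, P 0 = 1 ∧ (∀ k, HasMatMul (P k) W (P (k + 1))) ∧
    ∀ i j, HasSum (fun k => P k i j) (S i j)

/-! ### Continuous-time Markov chains on a countable state space -/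

/-- `Q` is a (conservative) infinitesimal generator. -/
def IsGenerator {E : Type*} (Q : Matrix E E ℝ) : Prop :=
  (∀ i j, i ≠ j → 0 ≤ Q i j) ∧ ∀ i, HasSum (fun j => Q i j) 0

/-- Any state can be reached from any state through transitions of positive rate. -/
def IsIrreducibleGenerator {E : Type*} (Q : Matrix E E ℝ) : Prop :=
  ∀ i j, Relation.ReflTransGen (fun a b => 0 < Q a b) i j

/-- Transition probabilities of the embedded jump chain. -/
def jumpProb {E : Type*} [DecidableEq E] (Q : Matrix E E ℝ) (i j : E) : ℝ≥0∞ :=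
  if Q i i = 0 then (if i = j then 1 else 0)
  else if i = j then 0 else ENNReal.ofReal (Q i j / (-Q i i))

/-- `tabooProb Q i n j` is the probability that the jump chain `Y` started at `Y 0 = i` has
`Y n = j` and `Y m ≠ i` for `1 ≤ m ≤ n`. -/
def tabooProb {E : Type*} [DecidableEq E] (Q : Matrix E E ℝ) (i : E) : ℕ → E → ℝ≥0∞
  | 0 => fun j => if j = i then 1 else 0
  | n + 1 => fun k => if k = i then 0 else ∑' j, tabooProb Q i n j * jumpProb Q j k

/-- The probability of ever returning to `i`: the sum over `n` of the probabilities that the first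
return of the jump chain to `i` happens at step `n + 1`. -/
def returnProb {E : Type*} [DecidableEq E] (Q : Matrix E E ℝ) (i : E) : ℝ≥0∞ :=
  ∑' n, ∑' j, tabooProb Q i n j * jumpProb Q j i

/-- The expected time spent until the first return to `i`: before its first return the chain makes
its `n`-th visit in `j` with probability `tabooProb Q i n j`, and then stays there for an
exponential time with mean `1 / (-Q j j)`. -/
def meanReturnTime {E : Type*} [DecidableEq E] (Q : Matrix E E ℝ) (i : E) : ℝ≥0∞ :=
  ∑' n, ∑' j, tabooProb Q i n j * (ENNReal.ofReal (-Q j j))⁻¹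

/-- Every state is absorbing, or is returned to with probability one and in finite mean time. -/
def IsPositiveRecurrent {E : Type*} [DecidableEq E] (Q : Matrix E E ℝ) : Prop :=
  ∀ i, Q i i = 0 ∨ (returnProb Q i = 1 ∧ meanReturnTime Q i ≠ ∞)

/-- `x` is a stationary probability vector: `x ≥ 0`, `x e = 1`, `x Q = 0`. -/
def IsStationaryProb {E : Type*} (Q : Matrix E E ℝ) (x : E → ℝ) : Prop :=
  (∀ i, 0 ≤ x i) ∧ HasSum x 1 ∧ HasVecMul x Q 0

/-! ### Level-dependent QBD processes -/

/-- The blocks of a level-dependent QBD process. `α` is the set of phases of level `0`, and `β` is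
the set of phases of every level `k ≥ 1`. Level `0` has the blocks `B1 = A_1^{(0)}`,
`B0 = A_0^{(0)}` and level `1` has the downward block `B2 = A_2^{(1)}`; `A0 k`, `A1 k` (`k ≥ 1`) and
`A2 k` (`k ≥ 2`) are `A_0^{(k)}`, `A_1^{(k)}`, `A_2^{(k)}`; their other values are never used. -/
structure LDQBD (α β : Type*) where
  B1 : Matrix α α ℝ
  B0 : Matrix α β ℝ
  B2 : Matrix β α ℝ
  A0 : ℕ → Matrix β β ℝ
  A1 : ℕ → Matrix β β ℝ
  A2 : ℕ → Matrix β β ℝ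

/-- The infinite matrix with the given `β × β` blocks; block rows and columns are numbered
`0, 1, 2, …`. -/
def blockMatrix {β : Type*} (F : ℕ → ℕ → Matrix β β ℝ) : Matrix (ℕ × β) (ℕ × β) ℝ :=
  fun p q => F p.1 q.1 p.2 q.2

namespace LDQBD

variable {α β : Type*}

/-- The block tridiagonal matrix `Q̂` of levels `1, 2, …`; block row `i` belongs to
level `i + 1`. -/
def Qhat (D : LDQBD α β) : Matrix (ℕ × β) (ℕ × β) ℝ :=
  blockMatrix fun i j =>
    if j = i then D.A1 (i + 1)
    else if j = i + 1 then D.A0 (i + 1)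
    else if i = j + 1 then D.A2 (i + 1)
    else 0

/-- The generator `Q`; the state `Sum.inl a` is phase `a` of level `0`, and `Sum.inr (i, b)` is
phase `b` of level `i + 1`. -/
def generator (D : LDQBD α β) : Matrix (α ⊕ ℕ × β) (α ⊕ ℕ × β) ℝ :=
  Matrix.fromBlocks D.B1
    (fun a p => if p.1 = 0 then D.B0 a p.2 else 0)
    (fun p a => if p.1 = 0 then D.B2 p.2 a else 0)
    D.Qhat

/-- The matrix `ℚ` whose first block row is `0` and whose other block rows are those of `Q̂`. -/
def shiftedQhat (D : LDQBD α β) : Matrix (ℕ × β) (ℕ × β) ℝ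
  | (0, _), _ => 0
  | (i + 1, b), q => D.Qhat (i, b) q

/-- `(π_1, π_2, …)` with `π_{i+1} = ∑_{j ≥ i+1} x_j`. -/
def tail (x : α ⊕ ℕ × β → ℝ) : ℕ × β → ℝ :=
  fun p => ∑' j : ℕ, x (Sum.inr (p.1 + j, p.2))

/-- The row vector `-(x_0 A_0^{(0)}, 0, 0, …)`. -/
def boundaryVec [Fintype α] (D : LDQBD α β) (x : α ⊕ ℕ × β → ℝ) : ℕ × β → ℝ :=
  fun p => if p.1 = 0 then -(Matrix.vecMul (fun a => x (Sum.inl a)) D.B0 p.2) else 0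

variable [Fintype β] [DecidableEq β]

/-- The `U`-measure `Ψ_k`. -/
def Psi (D : LDQBD α β) : ℕ → Matrix β β ℝ
  | 0 => D.A1 1
  | k + 1 => D.A1 (k + 2) + D.A2 (k + 2) * (-(Psi D k)⁻¹) * D.A0 (k + 1)

/-- The `R`-measure `𝐑_k`, `k ≥ 1` (the value at `0` is not used). -/
def R (D : LDQBD α β) : ℕ → Matrix β β ℝ
  | 0 => 0
  | k + 1 => D.A2 (k + 2) * (-(D.Psi k)⁻¹)

/-- The `G`-measure `𝐆_k`, `k ≥ 0`. -/
def G (D : LDQBD α β) (k : ℕ) : Matrix β β ℝ :=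
  (-(D.Psi k)⁻¹) * D.A0 (k + 1)

/-- `X_k^{(l)} = 𝐑_l 𝐑_{l-1} ⋯ 𝐑_{l-k+1}` for `k ≤ l` (and `X_0^{(l)} = I`). -/
def X (D : LDQBD α β) (l : ℕ) : ℕ → Matrix β β ℝ
  | 0 => 1
  | k + 1 => X D l k * D.R (l - k)

/-- `Y_k^{(l)} = 𝐆_l 𝐆_{l+1} ⋯ 𝐆_{l+k-1}` (and `Y_0^{(l)} = I`). -/
def Y (D : LDQBD α β) (l : ℕ) : ℕ → Matrix β β ℝ
  | 0 => 1
  | k + 1 => Y D l k * D.G (l + k)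

/-- `ℝ_L`, with the blocks `𝐑_1, 𝐑_2, …` below the diagonal. -/
def RL (D : LDQBD α β) : Matrix (ℕ × β) (ℕ × β) ℝ :=
  blockMatrix fun i j => if i = j + 1 then D.R i else 0

/-- `𝕌_D = diag(Ψ_0, Ψ_1, …)`. -/
def UD (D : LDQBD α β) : Matrix (ℕ × β) (ℕ × β) ℝ :=
  blockMatrix fun i j => if i = j then D.Psi i else 0

/-- `𝔾_U`, with the blocks `𝐆_0, 𝐆_1, …` above the diagonal. -/
def GU (D : LDQBD α β) : Matrix (ℕ × β) (ℕ × β) ℝ :=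
  blockMatrix fun i j => if j = i + 1 then D.G i else 0

/-- `(I - ℝ_L)⁻¹`: the block lower triangular matrix with the blocks `X_{i-j}^{(i)}`. -/
def RLinv (D : LDQBD α β) : Matrix (ℕ × β) (ℕ × β) ℝ :=
  blockMatrix fun i j => if j ≤ i then D.X i (i - j) else 0

/-- `𝕌_D⁻¹ = diag(Ψ_0⁻¹, Ψ_1⁻¹, …)`. -/
def UDinv (D : LDQBD α β) : Matrix (ℕ × β) (ℕ × β) ℝ :=
  blockMatrix fun i j => if i = j then (D.Psi i)⁻¹ else 0

/-- `(I - 𝔾_U)⁻¹`: the block upper triangular matrix with the blocks `Y_{j-i}^{(i)}`. -/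
def GUinv (D : LDQBD α β) : Matrix (ℕ × β) (ℕ × β) ℝ :=
  blockMatrix fun i j => if i ≤ j then D.Y i (j - i) else 0

/-- `S` solves `S_{k+1} S_k A_0^{(k)} + S_{k+1} A_1^{(k+1)} + A_2^{(k+2)} = 0` for `k ≥ 1`, with
`S_1 = A_2^{(2)} (-Ψ_0⁻¹)`, and `S_k ≥ 0` for `k ≥ 1`. -/
def IsNonnegRSolution (D : LDQBD α β) (S : ℕ → Matrix β β ℝ) : Prop :=
  (∀ k, 1 ≤ k → ∀ a b, 0 ≤ S k a b) ∧ S 1 = D.A2 2 * (-(D.Psi 0)⁻¹) ∧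
    ∀ k, 1 ≤ k → S (k + 1) * S k * D.A0 k + S (k + 1) * D.A1 (k + 1) + D.A2 (k + 2) = 0

/-- `S` solves `A_0^{(k+1)} + A_1^{(k+1)} S_k + A_2^{(k+1)} S_{k-1} S_k = 0` for `k ≥ 1`, with
`S_0 = (-Ψ_0⁻¹) A_0^{(1)}`, and `S_k ≥ 0` for `k ≥ 0`. -/
def IsNonnegGSolution (D : LDQBD α β) (S : ℕ → Matrix β β ℝ) : Prop :=
  (∀ k, ∀ a b, 0 ≤ S k a b) ∧ S 0 = (-(D.Psi 0)⁻¹) * D.A0 1 ∧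
    ∀ k, 1 ≤ k → D.A0 (k + 1) + D.A1 (k + 1) * S k + D.A2 (k + 1) * S (k - 1) * S k = 0

end LDQBD

end

/-! Write `N k` for `-Ψ_k⁻¹`. Everything rests on block Gaussian elimination, on convergence of one
nonnegative series, and on uniqueness of subinvariant measures.

Signs. If `Ψ_l w ≤ 0`, extend `w` from block `l` to the earlier blocks by back substitution and by
zero elsewhere. The extension has finite support, vanishes on level `0`, and satisfies `Q u ≤ 0`
wherever `u` could be negative, so the minimum principle gives `w ≥ 0`
(`nonneg_of_Psi_mulVec_nonpos`). Hence `Ψ_l` is injective and `N l ≥ 0`. The equations for `R` and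
`G`, and the factorization, are then finite block algebra.

Inverse. Formally multiplying out the inverse factors gives `-∑_k Yb i k * N k * Xb k j`, a series
with nonnegative terms up to the sign. The stationary equations, iterated, bound it by `x` after
weighting its rows by the inflow from level `0`; irreducibility carries convergence to every row
(`summable_potentialTerm`). Instead of reassociating infinite products, the sum is shown to satisfy
first-order recursions equivalent to the rows and columns of `Q̂ V = I` and `V Q̂ = I`. Iterating
the same recursion for any other non-positive inverse shows maximality.

Tail. Since `Q̂ V = I`, `ℚ V` is the block shift, whose powers sum to the block lower triangular
matrix of identities. So both formulas for `π` reduce to `-(x_0 A_0^{(0)}, 0, …) V = (x_1, x_2, …)`.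
The left side is at most the right and, completed by `x_0`, is a subinvariant measure; recurrence
forces equality (`inflow_mul_potential`). -/

/-! ### Minimum principle and subinvariant measures of irreducible generators -/

section Potential

variable {E : Type*}

/-- Minimum principle for irreducible generators. -/
theorem nonneg_of_generator_mul_nonpos {Q : Matrix E E ℝ} (hQ : IsGenerator Q)
    (hirr : IsIrreducibleGenerator Q) (u : E → ℝ) (hfin : {i | u i ≠ 0}.Finite) (z : E)
    (hz : u z = 0) (h : ∀ i, u i < 0 → ∃ s ≤ 0, HasSum (fun j => Q i j * u j) s) (i : E) :
    0 ≤ u i := by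
  by_contra! hi
  obtain ⟨m, hm, hmin⟩ := Set.exists_min_image _ u hfin ⟨i, hi.ne⟩
  have hm0 : u m < 0 := (hmin i hi.ne).trans_lt hi
  have hle : ∀ j, u m ≤ u j := fun j => by
    by_cases hj : u j = 0
    · rw [hj]; exact hm0.le
    · exact hmin j hj
  -- The minimum value propagates along transitions, so it would be attained at `z`, where `u`
  -- vanishes.
  have step : ∀ j, Relation.ReflTransGen (fun a b => 0 < Q a b) m j → u j = u m := by
    intro j hj
    induction hj with
    | refl => rfl
    | @tail b c _ hbc ih =>
      obtain ⟨s, hs, hsum⟩ := h b (ih ▸ hm0)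
      -- Zero row sums allow subtracting the minimum; a nonpositive sum of nonnegative terms then
      -- has only zero terms.
      have h2 : HasSum (fun j => Q b j * (u j - u m)) (s - 0 * u m) := by
        simpa [mul_sub] using hsum.sub ((hQ.2 b).mul_right (u m))
      have hnn : ∀ j, 0 ≤ Q b j * (u j - u m) := fun j => by
        by_cases hbj : b = j
        · subst hbj; simp [ih]
        · exact mul_nonneg (hQ.1 b j hbj) (sub_nonneg.2 (hle j))
      have h3 := le_hasSum h2 c (fun j _ => hnn j)
      have h4 : Q b c * (u c - u m) = 0 := le_antisymm (by linarith) (hnn c)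
      rcases mul_eq_zero.1 h4 with h5 | h5
      · exact absurd h5 hbc.ne'
      · linarith
  have := step z (hirr m z)
  linarith

variable [DecidableEq E]

/-- The expected number of visits of the jump chain to a state before the return to `i`. -/
noncomputable def tabooMeasure (Q : Matrix E E ℝ) (i j : E) : ℝ≥0∞ := ∑' n, tabooProb Q i n j

theorem tabooMeasure_self (Q : Matrix E E ℝ) (i : E) : tabooMeasure Q i i = 1 := by
  unfold tabooMeasure
  rw [tsum_eq_single 0]
  · simp [tabooProb]
  · rintro (_ | n) hn
    · exact absurd rfl hn
    · simp [tabooProb]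

theorem tsum_tabooMeasure_mul (Q : Matrix E E ℝ) (i k : E) :
    ∑' j, tabooMeasure Q i j * jumpProb Q j k
      = ∑' n, ∑' j, tabooProb Q i n j * jumpProb Q j k := by
  simp_rw [tabooMeasure, ← ENNReal.tsum_mul_right]
  exact ENNReal.tsum_comm

/-- The taboo measure is invariant for the jump chain if `i` is recurrent. -/
theorem tabooMeasure_invariant {Q : Matrix E E ℝ} {i : E} (h : returnProb Q i = 1) (k : E) :
    ∑' j, tabooMeasure Q i j * jumpProb Q j k = tabooMeasure Q i k := by
  rw [tsum_tabooMeasure_mul]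
  by_cases hk : k = i
  · subst hk; rw [tabooMeasure_self]; exact h
  · rw [tabooMeasure, tsum_eq_zero_add' (f := fun n => tabooProb Q i n k) ENNReal.summable]
    simp only [tabooProb, hk, if_false, zero_add]

/-- The taboo measure is minimal among the subinvariant measures. -/
theorem mul_tabooMeasure_le {Q : Matrix E E ℝ} (i : E) (ν : E → ℝ≥0∞)
    (h : ∀ k, ∑' j, ν j * jumpProb Q j k ≤ ν k) (j : E) : ν i * tabooMeasure Q i j ≤ ν j := by
  -- Decompose taboo paths by their last step: one application of subinvariance turns the bound for
  -- `n` steps into the bound for `n + 1`. At `i` itself only step `0` contributes.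
  have key : ∀ n j, ∑ l ∈ Finset.range n, ν i * tabooProb Q i l j ≤ ν j := by
    intro n
    induction n with
    | zero => simp
    | succ n ih =>
      intro k
      rw [Finset.sum_range_succ']
      by_cases hk : k = i
      · subst hk; simp [tabooProb]
      · simp only [tabooProb, hk, if_false, mul_zero, add_zero]
        refine le_trans ?_ (h k)
        simp_rw [← ENNReal.tsum_mul_left]
        rw [← Summable.tsum_finsetSum (fun _ _ => ENNReal.summable)]
        refine ENNReal.tsum_le_tsum fun j => ?_
        simp_rw [← mul_assoc]
        rw [← Finset.sum_mul]
        gcongr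
        exact ih j
  rw [tabooMeasure, ← ENNReal.tsum_mul_left, ENNReal.tsum_eq_iSup_nat]
  exact iSup_le fun n => key n j

/-- For an irreducible recurrent jump chain every finite subinvariant measure is a multiple of the
taboo measure. -/
theorem eq_mul_tabooMeasure {Q : Matrix E E ℝ} (hirr : IsIrreducibleGenerator Q)
    (hdiag : ∀ j, Q j j < 0) {i : E} (hret : returnProb Q i = 1) (ν : E → ℝ≥0∞)
    (hfin : ∀ j, ν j ≠ ∞) (h : ∀ k, ∑' j, ν j * jumpProb Q j k ≤ ν k) (j : E) :
    ν j = ν i * tabooMeasure Q i j := by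
  -- The excess `d` over the multiple of the taboo measure is again subinvariant, because the taboo
  -- measure is invariant, and `d i = 0`. Its zero spreads backwards along transitions.
  choose d hd using fun j => exists_add_of_le (mul_tabooMeasure_le i ν h j)
  have hne : ∀ j, ν i * tabooMeasure Q i j ≠ ∞ := fun j =>
    ne_top_of_le_ne_top (hfin j) (mul_tabooMeasure_le i ν h j)
  have hdsub : ∀ k, ∑' j, d j * jumpProb Q j k ≤ d k := by
    intro k
    have h1 := h k
    have h2 : ∀ j, ν j * jumpProb Q j k
        = ν i * (tabooMeasure Q i j * jumpProb Q j k) + d j * jumpProb Q j k := fun j => by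
      rw [hd j, add_mul, mul_assoc]
    rw [tsum_congr h2, hd k, ENNReal.tsum_add, ENNReal.tsum_mul_left, tabooMeasure_invariant hret] at h1
    exact (ENNReal.add_le_add_iff_left (hne k)).1 h1
  have hdi : d i = 0 := by
    have h1 := hd i
    rw [tabooMeasure_self, mul_one] at h1
    have h2 : ν i + d i = ν i + 0 := by rw [add_zero]; exact h1.symm
    exact (ENNReal.add_right_inj (hfin i)).1 h2
  have hzero : d j = 0 := by
    have hpath := hirr j i
    induction hpath using Relation.ReflTransGen.head_induction_on with
    | refl => exact hdi
    | @head a c hac _ ih =>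
      have h1 : d a * jumpProb Q a c ≤ 0 := by
        rw [← ih]; exact (ENNReal.le_tsum a).trans (hdsub c)
      have hac' : a ≠ c := by
        rintro rfl; exact absurd hac (hdiag a).le.not_gt
      have hp : jumpProb Q a c ≠ 0 := by
        simp only [jumpProb, (hdiag a).ne, hac', if_false]
        exact (ENNReal.ofReal_pos.2 (div_pos hac (neg_pos.2 (hdiag a)))).ne'
      exact (mul_eq_zero.1 (le_antisymm h1 bot_le)).resolve_right hp
  rw [hd j, hzero, add_zero]

/-- The measure with the density `-Q j j` is subinvariant for the jump chain if `m Q ≤ 0`. -/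
theorem tsum_ofReal_mul_jumpProb_le {Q : Matrix E E ℝ} (hQ : IsGenerator Q)
    (hdiag : ∀ j, Q j j < 0) (m : E → ℝ) (hm : ∀ j, 0 ≤ m j)
    (h : ∀ j, ∃ s ≤ 0, HasSum (fun k => m k * Q k j) s) (k : E) :
    ∑' j, ENNReal.ofReal (-Q j j * m j) * jumpProb Q j k ≤ ENNReal.ofReal (-Q k k * m k) := by
  obtain ⟨s, hs, hsum⟩ := h k
  -- The jump chain has no self-transitions, so the diagonal term is moved to the right-hand side.
  have h1 := hsum.update k 0
  have hnn : ∀ j, 0 ≤ Function.update (fun j => m j * Q j k) k 0 j := fun j => by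
    by_cases hj : j = k
    · subst hj; simp
    · rw [Function.update_of_ne hj]
      exact mul_nonneg (hm j) (hQ.1 j k hj)
  have h2 : ∀ j, ENNReal.ofReal (-Q j j * m j) * jumpProb Q j k
      = ENNReal.ofReal (Function.update (fun j => m j * Q j k) k 0 j) := fun j => by
    by_cases hj : j = k
    · subst hj; simp [jumpProb, (hdiag j).ne]
    · rw [Function.update_of_ne hj]
      simp only [jumpProb, (hdiag j).ne, hj, if_false]
      have hq := neg_pos.2 (hdiag j)
      rw [← ENNReal.ofReal_mul (mul_nonneg hq.le (hm j))]
      congr 1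
      field_simp [(hdiag j).ne]
  simp_rw [h2]
  rw [← ENNReal.ofReal_tsum_of_nonneg hnn h1.summable, h1.tsum_eq]
  apply ENNReal.ofReal_le_ofReal
  linarith

/-- Nonnegative solutions of `m Q ≤ 0` which agree at a recurrent state are equal. -/
theorem eq_of_subinvariant {Q : Matrix E E ℝ} (hQ : IsGenerator Q)
    (hirr : IsIrreducibleGenerator Q) (hdiag : ∀ j, Q j j < 0) {i : E}
    (hret : returnProb Q i = 1) {m m' : E → ℝ} (hm : ∀ j, 0 ≤ m j) (hm' : ∀ j, 0 ≤ m' j)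
    (h : ∀ j, ∃ s ≤ 0, HasSum (fun k => m k * Q k j) s)
    (h' : ∀ j, ∃ s ≤ 0, HasSum (fun k => m' k * Q k j) s) (hi : m i = m' i) (j : E) :
    m j = m' j := by
  have h1 := eq_mul_tabooMeasure hirr hdiag hret (fun j => ENNReal.ofReal (-Q j j * m j))
    (fun _ => ENNReal.ofReal_ne_top) (tsum_ofReal_mul_jumpProb_le hQ hdiag m hm h) j
  have h2 := eq_mul_tabooMeasure hirr hdiag hret (fun j => ENNReal.ofReal (-Q j j * m' j))
    (fun _ => ENNReal.ofReal_ne_top) (tsum_ofReal_mul_jumpProb_le hQ hdiag m' hm' h') j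
  have hq := neg_pos.2 (hdiag j)
  rw [hi, ← h2, ENNReal.ofReal_eq_ofReal_iff (mul_nonneg hq.le (hm j))
    (mul_nonneg hq.le (hm' j))] at h1
  exact mul_left_cancel₀ hq.ne' h1

omit [DecidableEq E] in
/-- A stationary probability vector of an irreducible generator is positive. -/
theorem stationary_pos {Q : Matrix E E ℝ} (hQ : IsGenerator Q)
    (hirr : IsIrreducibleGenerator Q) {x : E → ℝ} (hx : IsStationaryProb Q x) (i : E) :
    0 < x i := by
  refine lt_of_le_of_ne (hx.1 i) fun hi => ?_
  -- In column `c` with `x c = 0` all terms are nonnegative with sum zero, so `x` vanishes at every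
  -- predecessor of `c`.
  have hz : ∀ j, x j = 0 := by
    intro j
    have hpath := hirr j i
    induction hpath using Relation.ReflTransGen.head_induction_on with
    | refl => exact hi.symm
    | @head a c hac _ ih =>
      have hnn : ∀ k, 0 ≤ x k * Q k c := fun k => by
        by_cases hk : k = c
        · subst hk; simp [ih]
        · exact mul_nonneg (hx.1 k) (hQ.1 k c hk)
      have h1 : x a * Q a c = 0 :=
        le_antisymm (le_hasSum (hx.2.2 c) a fun k _ => hnn k) (hnn a)
      exact (mul_eq_zero.1 h1).resolve_right hac.ne'
  have h1 := hx.2.1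
  rw [funext hz] at h1
  exact zero_ne_one (hasSum_zero.unique h1)

omit [DecidableEq E] in
/-- An irreducible generator on at least two states has a negative diagonal. -/
theorem diag_neg {Q : Matrix E E ℝ} (hQ : IsGenerator Q) (hirr : IsIrreducibleGenerator Q)
    [Nontrivial E] (i : E) : Q i i < 0 := by
  obtain ⟨j, hj⟩ := exists_ne i
  have hpos : ∃ k, i ≠ k ∧ 0 < Q i k := by
    by_contra! hno
    have : ∀ k, Relation.ReflTransGen (fun a b => 0 < Q a b) i k → k = i := by
      intro k hk
      induction hk with
      | refl => rfl
      | tail _ hbc ih =>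
        subst ih
        by_contra hne
        exact absurd hbc (hno _ (Ne.symm hne)).not_gt
    exact hj (this j (hirr i j))
  obtain ⟨k, hik, hk⟩ := hpos
  classical
  have h1 := (hQ.2 i).update i 0
  have h2 := le_hasSum h1 k fun l _ => by
    by_cases hl : l = i
    · subst hl; simp
    · rw [Function.update_of_ne hl]; exact hQ.1 i l (Ne.symm hl)
  rw [Function.update_of_ne hik.symm] at h2
  linarith

end Potential

/-! ### Reduction of entrywise series to finite sums of blocks -/

section FiniteSupport

variable {α β : Type*} [Fintype β]

theorem hasSum_prod_of_finset {f : ℕ × β → ℝ} (s : Finset ℕ) (h : ∀ i ∉ s, ∀ b, f (i, b) = 0) :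
    HasSum f (∑ i ∈ s, ∑ b, f (i, b)) := by
  rw [← Finset.sum_product']
  refine hasSum_sum_of_ne_finset_zero fun p hp => h p.1 (fun hs => hp ?_) p.2
  exact Finset.mem_product.2 ⟨hs, Finset.mem_univ _⟩

theorem hasSum_sum_prod_of_finset [Fintype α] {f : α ⊕ ℕ × β → ℝ} (s : Finset ℕ)
    (h : ∀ i ∉ s, ∀ b, f (Sum.inr (i, b)) = 0) :
    HasSum f (∑ a, f (Sum.inl a) + ∑ i ∈ s, ∑ b, f (Sum.inr (i, b))) := by
  rw [← Finset.sum_product' (f := fun i b => f (Sum.inr (i, b))),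
    ← Finset.sum_disjSum (Finset.univ : Finset α) (s ×ˢ Finset.univ) f]
  refine hasSum_sum_of_ne_finset_zero fun p hp => ?_
  rcases p with a | p
  · simp at hp
  · refine h p.1 (fun hs => hp ?_) p.2
    simpa using hs

/-- It is enough that one factor be banded: for each pair of outer indices only finitely many middle
blocks contribute, and convergence is automatic. -/
theorem hasMatMul_blockMatrix {F H K : ℕ → ℕ → Matrix β β ℝ}
    (h : ∀ i k, ∃ s : Finset ℕ, (∀ j ∉ s, F i j = 0 ∨ H j k = 0) ∧ ∑ j ∈ s, F i j * H j k = K i k) :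
    HasMatMul (blockMatrix F) (blockMatrix H) (blockMatrix K) := by
  rintro ⟨i, a⟩ ⟨k, c⟩
  obtain ⟨s, hs, hsum⟩ := h i k
  have h1 := hasSum_prod_of_finset (f := fun p => F i p.1 a p.2 * H p.1 k p.2 c) s
    fun j hj b => by rcases hs j hj with h0 | h0 <;> simp [h0]
  have h2 : ∑ j ∈ s, ∑ b, F i j a b * H j k b c = K i k a c := by
    rw [← hsum, Matrix.sum_apply]; rfl
  rw [h2] at h1
  exact h1

omit [Fintype β] in
theorem one_eq_blockMatrix [DecidableEq β] :
    (1 : Matrix (ℕ × β) (ℕ × β) ℝ) = blockMatrix fun i j => if i = j then 1 else 0 := by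
  ext ⟨i, a⟩ ⟨j, b⟩
  by_cases hij : i = j
  · subst hij
    by_cases hab : a = b
    · subst hab; simp [blockMatrix]
    · simp [blockMatrix, hab]
  · simp [blockMatrix, hij]

omit [Fintype β] in
theorem blockMatrix_sub (F H : ℕ → ℕ → Matrix β β ℝ) :
    blockMatrix F - blockMatrix H = blockMatrix fun i j => F i j - H i j := rfl

end FiniteSupport

/-- Entrywise nonnegative matrices. -/
def EntrywiseNonneg {I J : Type*} (M : Matrix I J ℝ) : Prop := ∀ a b, 0 ≤ M a b

namespace EntrywiseNonneg

variable {I J K : Type*}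

theorem mul [Fintype J] {M : Matrix I J ℝ} {N : Matrix J K ℝ} (hM : EntrywiseNonneg M)
    (hN : EntrywiseNonneg N) : EntrywiseNonneg (M * N) := fun a c =>
  Finset.sum_nonneg fun b _ => mul_nonneg (hM a b) (hN b c)

theorem add {M N : Matrix I J ℝ} (hM : EntrywiseNonneg M) (hN : EntrywiseNonneg N) :
    EntrywiseNonneg (M + N) := fun a b => add_nonneg (hM a b) (hN a b)

theorem zero : EntrywiseNonneg (0 : Matrix I J ℝ) := fun _ _ => le_rfl

theorem one [DecidableEq I] : EntrywiseNonneg (1 : Matrix I I ℝ) := fun a b => by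
  rw [Matrix.one_apply]; split_ifs <;> norm_num

end EntrywiseNonneg

/-! ### Rows, columns and signs of the blocks of the generator -/

namespace LDQBD

variable {α β : Type*} (D : LDQBD α β)

/-- Block `(i, j)` of `Q̂`. -/
def QhatBlock (i j : ℕ) : Matrix β β ℝ :=
  if j = i then D.A1 (i + 1)
  else if j = i + 1 then D.A0 (i + 1)
  else if i = j + 1 then D.A2 (i + 1)
  else 0

theorem Qhat_eq : D.Qhat = blockMatrix D.QhatBlock := rfl

@[simp] theorem QhatBlock_self (i : ℕ) : D.QhatBlock i i = D.A1 (i + 1) := by simp [QhatBlock]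

@[simp] theorem QhatBlock_up (i : ℕ) : D.QhatBlock i (i + 1) = D.A0 (i + 1) := by simp [QhatBlock]

@[simp] theorem QhatBlock_down (i : ℕ) : D.QhatBlock (i + 1) i = D.A2 (i + 2) := by
  simp [QhatBlock, show i ≠ i + 1 + 1 by lia]

theorem QhatBlock_eq_zero {i j : ℕ} (h1 : j ≠ i) (h2 : j ≠ i + 1) (h3 : i ≠ j + 1) :
    D.QhatBlock i j = 0 := by simp [QhatBlock, h1, h2, h3]

section Generator

@[simp] theorem generator_inr_inr (i j : ℕ) (b c : β) :
    D.generator (Sum.inr (i, b)) (Sum.inr (j, c)) = D.QhatBlock i j b c := rfl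

@[simp] theorem generator_inl_inl (a a' : α) :
    D.generator (Sum.inl a) (Sum.inl a') = D.B1 a a' := rfl

@[simp] theorem generator_inl_inr (a : α) (i : ℕ) (b : β) :
    D.generator (Sum.inl a) (Sum.inr (i, b)) = if i = 0 then D.B0 a b else 0 := rfl

@[simp] theorem generator_inr_inl (a : α) (i : ℕ) (b : β) :
    D.generator (Sum.inr (i, b)) (Sum.inl a) = if i = 0 then D.B2 b a else 0 := rfl

variable [Fintype α] [Fintype β]

theorem hasSum_generator_row_zero (b : β) (u : α ⊕ ℕ × β → ℝ) :
    HasSum (fun j => D.generator (Sum.inr (0, b)) j * u j)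
      (∑ a, D.B2 b a * u (Sum.inl a) + (∑ c, D.A1 1 b c * u (Sum.inr (0, c))
        + ∑ c, D.A0 1 b c * u (Sum.inr (1, c)))) := by
  have := hasSum_sum_prod_of_finset
    (f := fun j => D.generator (Sum.inr (0, b)) j * u j) {0, 1} fun i hi c => by
      simp only [Finset.mem_insert, Finset.mem_singleton, not_or] at hi
      rw [generator_inr_inr, QhatBlock_eq_zero _ (by lia) (by lia) (by lia)]; simp
  rw [Finset.sum_pair (by simp)] at this
  simpa using this

theorem hasSum_generator_row_succ (i : ℕ) (b : β) (u : α ⊕ ℕ × β → ℝ) :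
    HasSum (fun j => D.generator (Sum.inr (i + 1, b)) j * u j)
      (∑ c, D.A2 (i + 2) b c * u (Sum.inr (i, c)) + (∑ c, D.A1 (i + 2) b c * u (Sum.inr (i + 1, c))
        + ∑ c, D.A0 (i + 2) b c * u (Sum.inr (i + 2, c)))) := by
  have := hasSum_sum_prod_of_finset
    (f := fun j => D.generator (Sum.inr (i + 1, b)) j * u j) {i, i + 1, i + 2} fun j hj c => by
      simp only [Finset.mem_insert, Finset.mem_singleton, not_or] at hj
      rw [generator_inr_inr, QhatBlock_eq_zero _ (by lia) (by lia) (by lia)]; simp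
  rw [Finset.sum_insert (by simp), Finset.sum_pair (by simp)] at this
  simpa [QhatBlock_up D (i + 1)] using this

theorem hasSum_generator_col_inl (a : α) (u : α ⊕ ℕ × β → ℝ) :
    HasSum (fun j => u j * D.generator j (Sum.inl a))
      (∑ a', u (Sum.inl a') * D.B1 a' a + ∑ c, u (Sum.inr (0, c)) * D.B2 c a) := by
  have := hasSum_sum_prod_of_finset
    (f := fun j => u j * D.generator j (Sum.inl a)) {0} fun j hj c => by
      simp only [Finset.mem_singleton] at hj
      simp [hj]
  simpa using this

theorem hasSum_generator_col_zero (b : β) (u : α ⊕ ℕ × β → ℝ) :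
    HasSum (fun j => u j * D.generator j (Sum.inr (0, b)))
      (∑ a, u (Sum.inl a) * D.B0 a b + (∑ c, u (Sum.inr (0, c)) * D.A1 1 c b
        + ∑ c, u (Sum.inr (1, c)) * D.A2 2 c b)) := by
  have := hasSum_sum_prod_of_finset
    (f := fun j => u j * D.generator j (Sum.inr (0, b))) {0, 1} fun i hi c => by
      simp only [Finset.mem_insert, Finset.mem_singleton, not_or] at hi
      rw [generator_inr_inr, QhatBlock_eq_zero _ (by lia) (by lia) (by lia)]; simp
  rw [Finset.sum_pair (by simp)] at this
  simpa [QhatBlock_down D 0] using this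

theorem hasSum_generator_col_succ (i : ℕ) (b : β) (u : α ⊕ ℕ × β → ℝ) :
    HasSum (fun j => u j * D.generator j (Sum.inr (i + 1, b)))
      (∑ c, u (Sum.inr (i, c)) * D.A0 (i + 1) c b + (∑ c, u (Sum.inr (i + 1, c)) * D.A1 (i + 2) c b
        + ∑ c, u (Sum.inr (i + 2, c)) * D.A2 (i + 3) c b)) := by
  have := hasSum_sum_prod_of_finset
    (f := fun j => u j * D.generator j (Sum.inr (i + 1, b))) {i, i + 1, i + 2} fun j hj c => by
      simp only [Finset.mem_insert, Finset.mem_singleton, not_or] at hj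
      rw [generator_inr_inr, QhatBlock_eq_zero _ (by lia) (by lia) (by lia)]; simp
  rw [Finset.sum_insert (by simp), Finset.sum_pair (by simp)] at this
  simpa [QhatBlock_down D (i + 1)] using this

end Generator

section BlockSigns

variable {D}

theorem A0_nonneg (h : IsGenerator D.generator) (k : ℕ) : EntrywiseNonneg (D.A0 (k + 1)) :=
  fun a b => by simpa using h.1 (Sum.inr (k, a)) (Sum.inr (k + 1, b)) (by simp)

theorem A2_nonneg (h : IsGenerator D.generator) (k : ℕ) : EntrywiseNonneg (D.A2 (k + 2)) :=
  fun a b => by simpa using h.1 (Sum.inr (k + 1, a)) (Sum.inr (k, b)) (by simp)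

theorem A1_offDiag_nonneg (h : IsGenerator D.generator) (k : ℕ) {a b : β} (hab : a ≠ b) :
    0 ≤ D.A1 (k + 1) a b := by
  simpa using h.1 (Sum.inr (k, a)) (Sum.inr (k, b)) (by simpa using hab)

theorem B2_nonneg (h : IsGenerator D.generator) : EntrywiseNonneg D.B2 :=
  fun b a => by simpa using h.1 (Sum.inr (0, b)) (Sum.inl a) (by simp)

theorem B0_nonneg (h : IsGenerator D.generator) : EntrywiseNonneg D.B0 :=
  fun a b => by simpa using h.1 (Sum.inl a) (Sum.inr (0, b)) (by simp)

variable [Fintype α] [Fintype β]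

theorem sum_row_zero (h : IsGenerator D.generator) (b : β) :
    ∑ a, D.B2 b a + (∑ c, D.A1 1 b c + ∑ c, D.A0 1 b c) = 0 := by
  have := (D.hasSum_generator_row_zero b fun _ => 1).unique
    (by simpa using h.2 (Sum.inr (0, b)))
  simpa using this

theorem sum_row_succ (h : IsGenerator D.generator) (i : ℕ) (b : β) :
    ∑ c, D.A2 (i + 2) b c + (∑ c, D.A1 (i + 2) b c + ∑ c, D.A0 (i + 2) b c) = 0 := by
  have := (D.hasSum_generator_row_succ i b fun _ => 1).unique
    (by simpa using h.2 (Sum.inr (i + 1, b)))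
  simpa using this

end BlockSigns

/-! ### Block recursions for the inverses of the triangular factors -/

section Blocks

variable [Fintype β] [DecidableEq β]

/-- Block `(i, k)` of `(I - 𝔾_U)⁻¹`. -/
noncomputable def Yb (i k : ℕ) : Matrix β β ℝ := if i ≤ k then D.Y i (k - i) else 0

/-- Block `(k, j)` of `(I - ℝ_L)⁻¹`. -/
noncomputable def Xb (k j : ℕ) : Matrix β β ℝ := if j ≤ k then D.X k (k - j) else 0

/-- The negative of the inverse of `Ψ_k`. -/
noncomputable def N (k : ℕ) : Matrix β β ℝ := -(D.Psi k)⁻¹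

theorem GUinv_eq : D.GUinv = blockMatrix D.Yb := rfl

theorem RLinv_eq : D.RLinv = blockMatrix D.Xb := rfl

theorem G_eq (k : ℕ) : D.G k = D.N k * D.A0 (k + 1) := rfl

theorem R_succ_eq (k : ℕ) : D.R (k + 1) = D.A2 (k + 2) * D.N k := rfl

theorem Psi_succ (k : ℕ) :
    D.Psi (k + 1) = D.A1 (k + 2) + D.A2 (k + 2) * D.N k * D.A0 (k + 1) := rfl

theorem Psi_succ_eq_G (k : ℕ) : D.Psi (k + 1) = D.A1 (k + 2) + D.A2 (k + 2) * D.G k := by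
  rw [Psi_succ, G_eq, mul_assoc]

theorem Psi_succ_eq_R (k : ℕ) :
    D.Psi (k + 1) = D.A1 (k + 2) + D.R (k + 1) * D.A0 (k + 1) := rfl

@[simp] theorem Yb_self (i : ℕ) : D.Yb i i = 1 := by simp [Yb, Y]

@[simp] theorem Xb_self (i : ℕ) : D.Xb i i = 1 := by simp [Xb, X]

theorem Yb_eq_zero {i k : ℕ} (h : k < i) : D.Yb i k = 0 := by simp [Yb, h]

theorem Xb_eq_zero {k j : ℕ} (h : k < j) : D.Xb k j = 0 := by simp [Xb, h]

/-- Peeling the product at its other end: the two sides of the inverse identity need the two ends.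
-/
theorem Y_succ' (l k : ℕ) : D.Y l (k + 1) = D.G l * D.Y (l + 1) k := by
  induction k with
  | zero => simp [Y]
  | succ k ih => rw [Y, ih, Y, mul_assoc, show l + (k + 1) = l + 1 + k by ring]

theorem X_succ' (l k : ℕ) : D.X (l + 1) (k + 1) = D.R (l + 1) * D.X l k := by
  induction k with
  | zero => simp [X]
  | succ k ih => rw [X, ih, X, mul_assoc, show l + 1 - (k + 1) = l - k by lia]

theorem Yb_succ {i k : ℕ} (h : i ≤ k) : D.Yb i (k + 1) = D.Yb i k * D.G k := by
  have h1 : k + 1 - i = (k - i) + 1 := by lia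
  have h2 : i + (k - i) = k := by lia
  simp [Yb, h, show i ≤ k + 1 by lia, h1, Y, h2]

theorem Xb_succ {k j : ℕ} (h : j ≤ k) : D.Xb (k + 1) j = D.R (k + 1) * D.Xb k j := by
  have h1 : k + 1 - j = (k - j) + 1 := by lia
  simp [Xb, h, show j ≤ k + 1 by lia, h1, X_succ']

/-- Entrywise form of `(I - 𝔾_U)⁻¹ (I - 𝔾_U) = I`, stated for all `i`, `k` so that later sums need
no case split; `Yb_eq` is the identity for the other order. -/
theorem Yb_succ_eq (i k : ℕ) :
    D.Yb i (k + 1) = (if i = k + 1 then 1 else 0) + D.Yb i k * D.G k := by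
  rcases Nat.lt_trichotomy i (k + 1) with h | h | h
  · simp [h.ne, D.Yb_succ (Nat.lt_succ_iff.1 h)]
  · subst h; simp [D.Yb_eq_zero (Nat.lt_succ_self k)]
  · simp [h.ne', D.Yb_eq_zero h, D.Yb_eq_zero (show k < i by lia)]

theorem Xb_succ_eq (k j : ℕ) :
    D.Xb (k + 1) j = (if k + 1 = j then 1 else 0) + D.R (k + 1) * D.Xb k j := by
  rcases Nat.lt_trichotomy j (k + 1) with h | h | h
  · simp [h.ne', D.Xb_succ (Nat.lt_succ_iff.1 h)]
  · subst h; simp [D.Xb_eq_zero (Nat.lt_succ_self k)]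
  · simp [h.ne, D.Xb_eq_zero h, D.Xb_eq_zero (show k < j by lia)]

theorem Yb_zero_right (i : ℕ) : D.Yb i 0 = if i = 0 then 1 else 0 := by
  split_ifs with h
  · subst h; simp
  · exact D.Yb_eq_zero (Nat.pos_of_ne_zero h)

theorem Xb_zero_left (j : ℕ) : D.Xb 0 j = if 0 = j then 1 else 0 := by
  split_ifs with h
  · subst h; simp
  · exact D.Xb_eq_zero (Nat.pos_of_ne_zero (Ne.symm h))

theorem Yb_eq (i k : ℕ) : D.Yb i k = (if i = k then 1 else 0) + D.G i * D.Yb (i + 1) k := by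
  rcases Nat.lt_trichotomy i k with h | h | h
  · obtain ⟨d, rfl⟩ : ∃ d, k = i + 1 + d := ⟨k - (i + 1), by lia⟩
    simp [Yb, h.ne, show i ≤ i + 1 + d by lia, show i + 1 + d - i = d + 1 by lia, Y_succ']
  · subst h; simp [D.Yb_eq_zero (Nat.lt_succ_self i)]
  · simp [h.ne', D.Yb_eq_zero h, D.Yb_eq_zero (show k < i + 1 by lia)]

theorem Xb_eq (k j : ℕ) : D.Xb k j = (if k = j then 1 else 0) + D.Xb k (j + 1) * D.R (j + 1) := by
  rcases Nat.lt_trichotomy j k with h | rfl | h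
  · obtain ⟨d, rfl⟩ : ∃ d, k = j + 1 + d := ⟨k - (j + 1), by lia⟩
    simp [Xb, h.ne', show j ≤ j + 1 + d by lia, show j + 1 + d - j = d + 1 by lia, X,
      show j + 1 + d - d = j + 1 by lia]
  · simp [D.Xb_eq_zero (Nat.lt_succ_self j)]
  · simp [h.ne, D.Xb_eq_zero h, D.Xb_eq_zero (show k < j + 1 by lia)]

theorem RL_factor_inverse : IsMatInverse (1 - D.RL) D.RLinv := by
  rw [IsMatInverse, RL, RLinv_eq, one_eq_blockMatrix, blockMatrix_sub]
  constructor
  · refine hasMatMul_blockMatrix fun i k => ?_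
    rcases i with _ | i
    · refine ⟨{0}, fun j hj => Or.inl ?_, ?_⟩
      · simp only [Finset.mem_singleton] at hj
        simp [Ne.symm hj]
      · simp [Xb_zero_left]
    · refine ⟨{i, i + 1}, fun j hj => Or.inl ?_, ?_⟩
      · simp only [Finset.mem_insert, Finset.mem_singleton, not_or] at hj
        simp [Ne.symm hj.1, Ne.symm hj.2]
      · rw [Finset.sum_pair (by simp)]
        simp [D.Xb_succ_eq i k]
  · refine hasMatMul_blockMatrix fun i k => ⟨{k, k + 1}, fun j hj => Or.inr ?_, ?_⟩
    · simp only [Finset.mem_insert, Finset.mem_singleton, not_or] at hj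
      simp [hj.1, hj.2]
    · rw [Finset.sum_pair (by simp)]
      simp [D.Xb_eq i k]

theorem GU_factor_inverse : IsMatInverse (1 - D.GU) D.GUinv := by
  rw [IsMatInverse, GU, GUinv_eq, one_eq_blockMatrix, blockMatrix_sub]
  constructor
  · refine hasMatMul_blockMatrix fun i k => ⟨{i, i + 1}, fun j hj => Or.inl ?_, ?_⟩
    · simp only [Finset.mem_insert, Finset.mem_singleton, not_or] at hj
      simp [Ne.symm hj.1, hj.2]
    · rw [Finset.sum_pair (by simp)]
      simp [D.Yb_eq i k]
  · refine hasMatMul_blockMatrix fun i k => ?_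
    rcases k with _ | k
    · refine ⟨{0}, fun j hj => Or.inr ?_, ?_⟩
      · simp only [Finset.mem_singleton] at hj
        simp [hj]
      · simp [Yb_zero_right]
    · refine ⟨{k, k + 1}, fun j hj => Or.inr ?_, ?_⟩
      · simp only [Finset.mem_insert, Finset.mem_singleton, not_or] at hj
        simp [hj.2, Ne.symm hj.1]
      · rw [Finset.sum_pair (by simp)]
        simp [D.Yb_succ_eq i k]

end Blocks

end LDQBD

/-! ### Invertibility and signs of the `U`-measures -/

namespace LDQBD

variable {α β : Type*} [Fintype β] [DecidableEq β] {D : LDQBD α β}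

omit [DecidableEq β] in
theorem mulVec_one_apply (M : Matrix β β ℝ) (a : β) : M.mulVec 1 a = ∑ b, M a b := by
  simp [Matrix.mulVec, dotProduct]

theorem Psi_mul_N {k : ℕ} (hu : IsUnit (D.Psi k)) : D.Psi k * D.N k = -1 := by
  rw [N, mul_neg, Matrix.mul_nonsing_inv _ ((Matrix.isUnit_iff_isUnit_det _).1 hu)]

theorem N_mul_Psi {k : ℕ} (hu : IsUnit (D.Psi k)) : D.N k * D.Psi k = -1 := by
  rw [N, neg_mul, Matrix.nonsing_inv_mul _ ((Matrix.isUnit_iff_isUnit_det _).1 hu)]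

theorem Psi_mul_G {k : ℕ} (hu : IsUnit (D.Psi k)) : D.Psi k * D.G k = -D.A0 (k + 1) := by
  rw [G_eq, ← mul_assoc, Psi_mul_N hu, neg_one_mul]

theorem R_mul_Psi {k : ℕ} (hu : IsUnit (D.Psi k)) : D.R (k + 1) * D.Psi k = -D.A2 (k + 2) := by
  rw [R_succ_eq, mul_assoc, N_mul_Psi hu, mul_neg_one]

/-- Column `l` of `Q̂ (I - 𝔾_U)⁻¹ = (I - ℝ_L) 𝕌_D`, above and on the diagonal. Only `Ψ_k` with `k <
l` must be invertible, so this is available before `Ψ_l` is known to be. -/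
theorem Qhat_row_zero_mul_Yb {l : ℕ} (hu : ∀ k < l, IsUnit (D.Psi k)) :
    D.A1 1 * D.Yb 0 l + D.A0 1 * D.Yb 1 l = if l = 0 then D.Psi l else 0 := by
  rcases l with _ | l
  · simp [D.Yb_eq_zero (show 0 < 1 by simp), Psi]
  · have h1 : D.Yb 0 (l + 1) = D.G 0 * D.Yb 1 (l + 1) := by rw [D.Yb_eq]; simp
    have h2 : D.A1 1 * D.G 0 = -D.A0 1 := Psi_mul_G (hu 0 (by simp))
    rw [h1, ← mul_assoc, h2]; simp

theorem Qhat_row_succ_mul_Yb {l i : ℕ} (hi : i + 1 ≤ l) (hu : ∀ k < l, IsUnit (D.Psi k)) :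
    D.A2 (i + 2) * D.Yb i l + (D.A1 (i + 2) * D.Yb (i + 1) l + D.A0 (i + 2) * D.Yb (i + 2) l)
      = if i + 1 = l then D.Psi l else 0 := by
  have h1 : D.Yb i l = D.G i * D.Yb (i + 1) l := by
    rw [D.Yb_eq, if_neg (by lia), zero_add]
  have h2 : D.A2 (i + 2) * D.G i = D.Psi (i + 1) - D.A1 (i + 2) := by
    rw [Psi_succ_eq_G, add_sub_cancel_left]
  rw [h1, ← mul_assoc, h2, sub_mul]
  split_ifs with hl
  · subst hl; simp [D.Yb_eq_zero (Nat.lt_succ_self (i + 1))]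
  · have h3 : D.Yb (i + 1) l = D.G (i + 1) * D.Yb (i + 2) l := by
      rw [D.Yb_eq, if_neg hl, zero_add]
    have h4 := Psi_mul_G (hu (i + 1) (by lia))
    have h5 : D.Psi (i + 1) * D.Yb (i + 1) l = -(D.A0 (i + 2) * D.Yb (i + 2) l) := by
      rw [h3, ← mul_assoc, h4, neg_mul]
    rw [h5]; abel

section

variable [Fintype α]

/-- `Ψ_l` is the Schur complement of the first `l` blocks, so the minimum principle for the
generator passes to it through back substitution. -/
theorem nonneg_of_Psi_mulVec_nonpos [Nonempty α] (h : IsGenerator D.generator)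
    (hirr : IsIrreducibleGenerator D.generator) {l : ℕ} (hu : ∀ k < l, IsUnit (D.Psi k))
    (w : β → ℝ) (hw : ∀ b, (D.Psi l).mulVec w b ≤ 0) (b : β) : 0 ≤ w b := by
  -- In blocks below `l` the row equations hold exactly and in block `l` they give `Ψ_l w`. Beyond
  -- `l` the row inequality may fail, but `u` is zero there and the minimum principle tests only
  -- negative values.
  let u : α ⊕ ℕ × β → ℝ := Sum.elim (fun _ => 0) fun p => (D.Yb p.1 l).mulVec w p.2
  have hzero : ∀ i, l < i → ∀ b, u (Sum.inr (i, b)) = 0 := fun i hi b => by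
    simp [u, D.Yb_eq_zero hi]
  have hfin : {i | u i ≠ 0}.Finite := by
    refine (((Finset.range (l + 1) ×ˢ (Finset.univ : Finset β)).finite_toSet).image
      (fun p => (Sum.inr p : α ⊕ ℕ × β))).subset ?_
    rintro (a | ⟨i, b⟩) hi
    · exact absurd rfl hi
    · by_cases hil : l < i
      · exact absurd (hzero i hil b) hi
      · simp; lia
  have key := nonneg_of_generator_mul_nonpos h hirr u hfin (Sum.inl (Classical.arbitrary α)) rfl
    (by
      rintro (a | ⟨i, b⟩) hi
      · exact absurd hi (lt_irrefl _)
      · rcases i with _ | i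
        · refine ⟨_, ?_, D.hasSum_generator_row_zero b u⟩
          have h1 := congrFun (congrArg (fun M => Matrix.mulVec M w) (Qhat_row_zero_mul_Yb hu)) b
          simp only [Matrix.add_mulVec, ← Matrix.mulVec_mulVec] at h1
          have h2 : ∑ a, D.B2 b a * u (Sum.inl a) = 0 := by simp [u]
          rw [h2, zero_add]
          refine (Eq.le h1).trans ?_
          split_ifs
          · exact hw b
          · simp
        · refine ⟨_, ?_, D.hasSum_generator_row_succ i b u⟩
          by_cases hil : i + 1 ≤ l
          · have h1 := congrFun
              (congrArg (fun M => Matrix.mulVec M w) (Qhat_row_succ_mul_Yb hil hu)) b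
            simp only [Matrix.add_mulVec, ← Matrix.mulVec_mulVec] at h1
            refine (Eq.le h1).trans ?_
            split_ifs
            · exact hw b
            · simp
          · rw [hzero _ (by lia)] at hi
            exact absurd hi (lt_irrefl _))
    (Sum.inr (l, b))
  simpa [u] using key

theorem isUnit_Psi [Nonempty α] (h : IsGenerator D.generator)
    (hirr : IsIrreducibleGenerator D.generator) (l : ℕ) : IsUnit (D.Psi l) := by
  induction l using Nat.strong_induction_on with
  | _ l ih =>
    rw [← Matrix.mulVec_injective_iff_isUnit]
    intro v w hvw
    have h1 : (D.Psi l).mulVec (v - w) = 0 := by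
      rw [Matrix.mulVec_sub]; exact sub_eq_zero.2 hvw
    have h2 : (D.Psi l).mulVec (w - v) = 0 := by
      rw [Matrix.mulVec_sub]; exact sub_eq_zero.2 hvw.symm
    funext b
    have h3 := nonneg_of_Psi_mulVec_nonpos h hirr ih (v - w) (fun b => by simp [h1]) b
    have h4 := nonneg_of_Psi_mulVec_nonpos h hirr ih (w - v) (fun b => by simp [h2]) b
    simp only [Pi.sub_apply] at h3 h4
    linarith

/-- Column `b` of `N l` is mapped by `Ψ_l` to `-e_b ≤ 0`. -/
theorem N_nonneg [Nonempty α] (h : IsGenerator D.generator)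
    (hirr : IsIrreducibleGenerator D.generator) (l : ℕ) : EntrywiseNonneg (D.N l) := fun a b => by
  refine nonneg_of_Psi_mulVec_nonpos h hirr (l := l)
    (fun k _ => isUnit_Psi h hirr k)
    (fun a => D.N l a b) (fun c => ?_) a
  have h1 := congrFun (congrFun (Psi_mul_N (isUnit_Psi h hirr l)) c) b
  rw [Matrix.mul_apply] at h1
  refine (Eq.le h1).trans ?_
  rw [Matrix.neg_apply, Matrix.one_apply]
  split_ifs <;> norm_num

variable [Nonempty α]

theorem G_nonneg (h : IsGenerator D.generator)
    (hirr : IsIrreducibleGenerator D.generator) (l : ℕ) : EntrywiseNonneg (D.G l) :=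
  (N_nonneg h hirr l).mul (A0_nonneg h l)

theorem R_nonneg (h : IsGenerator D.generator)
    (hirr : IsIrreducibleGenerator D.generator) : ∀ l, EntrywiseNonneg (D.R l)
  | 0 => EntrywiseNonneg.zero
  | l + 1 => (A2_nonneg h l).mul (N_nonneg h hirr l)

theorem Yb_nonneg (h : IsGenerator D.generator)
    (hirr : IsIrreducibleGenerator D.generator) (i k : ℕ) : EntrywiseNonneg (D.Yb i k) := by
  induction k with
  | zero => rw [Yb_zero_right]; split_ifs <;> [exact .one; exact .zero]
  | succ k ih =>
    rw [Yb_succ_eq]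
    refine .add ?_ (ih.mul (G_nonneg h hirr k))
    split_ifs <;> [exact .one; exact .zero]

theorem Xb_nonneg (h : IsGenerator D.generator)
    (hirr : IsIrreducibleGenerator D.generator) (k j : ℕ) : EntrywiseNonneg (D.Xb k j) := by
  induction k with
  | zero => rw [Xb_zero_left]; split_ifs <;> [exact .one; exact .zero]
  | succ k ih =>
    rw [Xb_succ_eq]
    refine .add ?_ ((R_nonneg h hirr (k + 1)).mul ih)
    split_ifs <;> [exact .one; exact .zero]

theorem Psi_offDiag_nonneg (h : IsGenerator D.generator)
    (hirr : IsIrreducibleGenerator D.generator) (l : ℕ) {a b : β} (hab : a ≠ b) :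
    0 ≤ D.Psi l a b := by
  rcases l with _ | l
  · exact A1_offDiag_nonneg h 0 hab
  · rw [Psi_succ_eq_G]
    exact add_nonneg (A1_offDiag_nonneg h (l + 1) hab)
      ((A2_nonneg h l).mul (G_nonneg h hirr l) a b)

/-- Keeping the `A0` term makes the induction close: multiplied by `N l` it says `G_l 1 ≤ 1`, which
bounds the next correction `A2 G_l 1` by `A2 1`. -/
theorem Psi_add_A0_row_sum_nonpos (h : IsGenerator D.generator)
    (hirr : IsIrreducibleGenerator D.generator) (l : ℕ) (a : β) :
    (D.Psi l).mulVec 1 a + (D.A0 (l + 1)).mulVec 1 a ≤ 0 := by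
  induction l generalizing a with
  | zero =>
    have h1 := sum_row_zero h a
    have h2 : 0 ≤ ∑ c, D.B2 a c := Finset.sum_nonneg fun c _ => B2_nonneg h a c
    simp only [mulVec_one_apply, Psi]
    linarith
  | succ l ih =>
    have h1 := sum_row_succ h l a
    have hG : ∀ b, (D.G l).mulVec 1 b ≤ 1 := by
      have h2 : (D.N l).mulVec ((D.Psi l).mulVec 1 + (D.A0 (l + 1)).mulVec 1)
          = -1 + (D.G l).mulVec 1 := by
        rw [Matrix.mulVec_add, Matrix.mulVec_mulVec, Matrix.mulVec_mulVec,
          N_mul_Psi (isUnit_Psi h hirr l), G_eq, Matrix.neg_mulVec, Matrix.one_mulVec]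
      intro b
      have h3 : (D.N l).mulVec ((D.Psi l).mulVec 1 + (D.A0 (l + 1)).mulVec 1) b ≤ 0 :=
        Finset.sum_nonpos fun c _ => mul_nonpos_of_nonneg_of_nonpos (N_nonneg h hirr l b c) (ih c)
      rw [h2] at h3
      simp only [Pi.add_apply, Pi.neg_apply, Pi.one_apply] at h3
      linarith
    have h4 : (D.A2 (l + 2)).mulVec ((D.G l).mulVec 1) a ≤ ∑ c, D.A2 (l + 2) a c :=
      Finset.sum_le_sum fun c _ => mul_le_of_le_one_right (A2_nonneg h l a c) (hG c)
    rw [Psi_succ_eq_G, Matrix.add_mulVec, ← Matrix.mulVec_mulVec]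
    rw [Pi.add_apply, mulVec_one_apply, mulVec_one_apply]
    linarith

theorem Psi_row_sum_nonpos (h : IsGenerator D.generator)
    (hirr : IsIrreducibleGenerator D.generator) (l : ℕ) (a : β) : ∑ b, D.Psi l a b ≤ 0 := by
  have h1 := Psi_add_A0_row_sum_nonpos h hirr l a
  have h2 : 0 ≤ ∑ c, D.A0 (l + 1) a c := Finset.sum_nonneg fun c _ => A0_nonneg h l a c
  simp only [mulVec_one_apply] at h1
  linarith

end

theorem R_mul_A0_add (k : ℕ) : D.R (k + 1) * D.A0 (k + 1) + D.A1 (k + 2) = D.Psi (k + 1) := by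
  rw [Psi_succ_eq_R, add_comm]

theorem A1_add_A2_mul_G (k : ℕ) : D.A1 (k + 2) + D.A2 (k + 2) * D.G k = D.Psi (k + 1) :=
  (D.Psi_succ_eq_G k).symm

theorem R_equation (hu : ∀ k, IsUnit (D.Psi k)) (k : ℕ) (hk : 1 ≤ k) :
    D.R (k + 1) * D.R k * D.A0 k + D.R (k + 1) * D.A1 (k + 1) + D.A2 (k + 2) = 0 := by
  obtain ⟨k, rfl⟩ := Nat.exists_eq_add_of_le' hk
  rw [mul_assoc, ← mul_add, R_mul_A0_add, R_mul_Psi (hu _), neg_add_cancel]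

theorem G_equation (hu : ∀ k, IsUnit (D.Psi k)) (k : ℕ) (hk : 1 ≤ k) :
    D.A0 (k + 1) + D.A1 (k + 1) * D.G k + D.A2 (k + 1) * D.G (k - 1) * D.G k = 0 := by
  obtain ⟨k, rfl⟩ := Nat.exists_eq_add_of_le' hk
  rw [add_assoc, ← add_mul, Nat.add_sub_cancel, A1_add_A2_mul_G, Psi_mul_G (hu _), add_neg_cancel]

/-- Once the previous term is known, the equation reads `S (k + 2) * Ψ_{k+1} = -A2 (k + 3)`, with
`Ψ_{k+1}` invertible. -/
theorem R_unique (hu : ∀ k, IsUnit (D.Psi k)) {S : ℕ → Matrix β β ℝ}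
    (hS : D.IsNonnegRSolution S) (k : ℕ) : S (k + 1) = D.R (k + 1) := by
  induction k with
  | zero => exact hS.2.1
  | succ k ih =>
    have h1 := hS.2.2 (k + 1) (by simp)
    rw [ih, mul_assoc, ← mul_add, R_mul_A0_add] at h1
    refine (hu (k + 1)).mul_right_cancel ?_
    rw [R_mul_Psi (hu _), eq_neg_of_add_eq_zero_left h1]

theorem G_unique (hu : ∀ k, IsUnit (D.Psi k)) {S : ℕ → Matrix β β ℝ}
    (hS : D.IsNonnegGSolution S) (k : ℕ) : S k = D.G k := by
  induction k with
  | zero => exact hS.2.1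
  | succ k ih =>
    have h1 := hS.2.2 (k + 1) (by simp)
    rw [Nat.add_sub_cancel, ih, add_assoc, ← add_mul, A1_add_A2_mul_G] at h1
    refine (hu (k + 1)).mul_left_cancel ?_
    rw [Psi_mul_G (hu _), eq_neg_of_add_eq_zero_right h1]

theorem R_recursion (k : ℕ) (hk : 1 ≤ k) :
    D.R (k + 1) = -(D.A2 (k + 2) * (D.R k * D.A0 k + D.A1 (k + 1))⁻¹) := by
  obtain ⟨k, rfl⟩ := Nat.exists_eq_add_of_le' hk
  rw [R_mul_A0_add, R_succ_eq, N, mul_neg]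

theorem G_recursion (k : ℕ) (hk : 1 ≤ k) :
    D.G k = -((D.A1 (k + 1) + D.A2 (k + 1) * D.G (k - 1))⁻¹ * D.A0 (k + 1)) := by
  obtain ⟨k, rfl⟩ := Nat.exists_eq_add_of_le' hk
  rw [Nat.add_sub_cancel, A1_add_A2_mul_G, G_eq, N, neg_mul]

theorem UD_inverse (hu : ∀ k, IsUnit (D.Psi k)) : IsMatInverse D.UD D.UDinv := by
  rw [IsMatInverse, UD, UDinv, one_eq_blockMatrix]
  have hdet := fun k => (Matrix.isUnit_iff_isUnit_det _).1 (hu k)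
  constructor
  · refine hasMatMul_blockMatrix fun i k => ⟨{i}, fun j hj => Or.inl ?_, ?_⟩
    · simp only [Finset.mem_singleton] at hj
      simp [Ne.symm hj]
    · by_cases h : i = k
      · subst h; simp [Matrix.mul_nonsing_inv _ (hdet i)]
      · simp [h]
  · refine hasMatMul_blockMatrix fun i k => ⟨{i}, fun j hj => Or.inl ?_, ?_⟩
    · simp only [Finset.mem_singleton] at hj
      simp [Ne.symm hj]
    · by_cases h : i = k
      · subst h; simp [Matrix.nonsing_inv_mul _ (hdet i)]
      · simp [h]

/-- The LU-type RG-factorization of `Q̂`. -/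
theorem Qhat_factorization (hu : ∀ k, IsUnit (D.Psi k)) :
    HasMatMul₃ (1 - D.RL) D.UD (1 - D.GU) D.Qhat := by
  rw [RL, UD, GU, one_eq_blockMatrix, blockMatrix_sub, blockMatrix_sub, Qhat_eq]
  -- The product `(I - ℝ_L) 𝕌_D` is block lower bidiagonal because `R_{k+1} Ψ_k = -A2 (k + 2)`.
  refine ⟨blockMatrix fun i j => if i = j then D.Psi i else if i = j + 1 then D.A2 (i + 1) else 0,
    hasMatMul_blockMatrix fun i k => ⟨{k}, fun j hj => Or.inr ?_, ?_⟩,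
    hasMatMul_blockMatrix fun i k => ?_⟩
  · simp only [Finset.mem_singleton] at hj
    simp [hj]
  · by_cases h1 : i = k
    · subst h1; simp
    · by_cases h2 : i = k + 1
      · subst h2; simp [R_mul_Psi (hu k)]
      · simp [h1, h2]
  · rcases i with _ | i
    · refine ⟨{0}, fun j hj => Or.inl ?_, ?_⟩
      · simp only [Finset.mem_singleton] at hj
        simp [Ne.symm hj]
      · rw [Finset.sum_singleton]
        rcases k with _ | _ | k
        · simp [Psi]
        · have h1 := Psi_mul_G (hu 0)
          simp [h1]
        · rw [QhatBlock_eq_zero _ (by lia) (by lia) (by lia)]; simp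
    · refine ⟨{i, i + 1}, fun j hj => Or.inl ?_, ?_⟩
      · simp only [Finset.mem_insert, Finset.mem_singleton, not_or] at hj
        simp [Ne.symm hj.1, Ne.symm hj.2]
      · rw [Finset.sum_pair (by simp)]
        by_cases h1 : k = i
        · subst h1; simp [show k ≠ k + 1 + 1 by lia]
        · by_cases h2 : k = i + 1
          · subst h2; simp [Psi_succ_eq_G]
          · by_cases h3 : k = i + 2
            · subst h3
              have h4 := Psi_mul_G (hu (i + 1))
              simp [h4]
            · rw [QhatBlock_eq_zero _ (by lia) (by lia) (by lia)]
              simp [Ne.symm h1, h2, Ne.symm h2, h3]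

/-! ### First-order recursions equivalent to linear systems for `Q̂` -/

section Potential

variable {γ : Type*}

/-- The recursion says `(I - 𝔾_U) h = -𝕌_D⁻¹ c`, which by the factorization is `Q̂ h = -(I - ℝ_L)
c`. Blocks `0` and `i + 1` are treated separately, and `recursion_of_Qhat_row` is the converse, by
forward elimination. -/
theorem Qhat_row_zero_of_recursion (hu : ∀ k, IsUnit (D.Psi k)) {h c : ℕ → Matrix β γ ℝ}
    (h0 : h 0 = D.G 0 * h 1 + D.N 0 * c 0) : D.A1 1 * h 0 + D.A0 1 * h 1 = -c 0 := by
  have h1 : D.A1 1 * D.G 0 = -D.A0 1 := Psi_mul_G (hu 0)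
  have h2 : D.A1 1 * D.N 0 = -1 := Psi_mul_N (hu 0)
  rw [h0, Matrix.mul_add, ← Matrix.mul_assoc, ← Matrix.mul_assoc, h1, h2, Matrix.neg_mul,
    Matrix.neg_mul, Matrix.one_mul]
  abel

theorem Qhat_row_succ_of_recursion (hu : ∀ k, IsUnit (D.Psi k)) {h c : ℕ → Matrix β γ ℝ} {i : ℕ}
    (h0 : h i = D.G i * h (i + 1) + D.N i * c i)
    (h1 : h (i + 1) = D.G (i + 1) * h (i + 2) + D.N (i + 1) * c (i + 1)) :
    D.A2 (i + 2) * h i + (D.A1 (i + 2) * h (i + 1) + D.A0 (i + 2) * h (i + 2))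
      = D.R (i + 1) * c i - c (i + 1) := by
  have h2 : D.Psi (i + 1) * h (i + 1) = -(D.A0 (i + 2) * h (i + 2)) - c (i + 1) := by
    rw [h1, Matrix.mul_add, ← Matrix.mul_assoc, ← Matrix.mul_assoc, Psi_mul_G (hu _),
      Psi_mul_N (hu _), Matrix.neg_mul, Matrix.neg_mul, Matrix.one_mul]
    abel
  rw [h0, Matrix.mul_add, ← Matrix.mul_assoc, ← Matrix.mul_assoc, ← R_succ_eq]
  rw [← A1_add_A2_mul_G, Matrix.add_mul] at h2
  rw [← sub_eq_zero] at h2 ⊢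
  rw [← h2]
  abel

theorem recursion_of_Qhat_row (hu : ∀ k, IsUnit (D.Psi k)) {h c : ℕ → Matrix β γ ℝ}
    (h0 : D.A1 1 * h 0 + D.A0 1 * h 1 = -c 0)
    (hs : ∀ i, D.A2 (i + 2) * h i + (D.A1 (i + 2) * h (i + 1) + D.A0 (i + 2) * h (i + 2))
      = D.R (i + 1) * c i - c (i + 1)) (i : ℕ) :
    h i = D.G i * h (i + 1) + D.N i * c i := by
  have key : ∀ i, D.Psi i * h i = -(D.A0 (i + 1) * h (i + 1)) - c i →
      h i = D.G i * h (i + 1) + D.N i * c i := by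
    intro i hi
    have h1 := congrArg (fun M => D.N i * M) hi
    simp only [← Matrix.mul_assoc, N_mul_Psi (hu i), Matrix.neg_mul, Matrix.one_mul,
      Matrix.mul_sub, Matrix.mul_neg, ← G_eq] at h1
    rw [← neg_inj, h1]
    abel
  induction i with
  | zero => exact key 0 (by rw [Psi, eq_sub_of_add_eq h0]; abel)
  | succ i ih =>
    refine key _ ?_
    have h1 := hs i
    rw [ih, Matrix.mul_add, ← Matrix.mul_assoc, ← Matrix.mul_assoc, ← R_succ_eq] at h1
    rw [← A1_add_A2_mul_G, Matrix.add_mul]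
    rw [← sub_eq_zero] at h1 ⊢
    rw [← h1]
    abel

theorem recursion_iterate_col {h c : ℕ → Matrix β γ ℝ}
    (hr : ∀ i, h i = D.G i * h (i + 1) + D.N i * c i) {i n : ℕ} (hin : i ≤ n) :
    h i = ∑ k ∈ Finset.range n, D.Yb i k * D.N k * c k + D.Yb i n * h n := by
  induction n, hin using Nat.le_induction with
  | base =>
    rw [Finset.sum_eq_zero fun k hk => by
      rw [D.Yb_eq_zero (Finset.mem_range.1 hk), Matrix.zero_mul, Matrix.zero_mul]]
    simp
  | succ n hn ih =>
    rw [Finset.sum_range_succ, Yb_succ _ hn]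
    conv_lhs => rw [ih, hr n]
    rw [Matrix.mul_add, Matrix.mul_assoc, Matrix.mul_assoc]
    abel

/-- The transposed correspondence: `h (I - ℝ_L) = -c 𝕌_D⁻¹` against `h Q̂ = -c (I - 𝔾_U)`. -/
theorem Qhat_col_zero_of_recursion (hu : ∀ k, IsUnit (D.Psi k)) {h c : ℕ → Matrix γ β ℝ}
    (h0 : h 0 = h 1 * D.R 1 + c 0 * D.N 0) : h 0 * D.A1 1 + h 1 * D.A2 2 = -c 0 := by
  have h1 : D.R 1 * D.A1 1 = -D.A2 2 := R_mul_Psi (hu 0)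
  have h2 : D.N 0 * D.A1 1 = -1 := N_mul_Psi (hu 0)
  rw [h0, Matrix.add_mul, Matrix.mul_assoc, Matrix.mul_assoc, h1, h2, Matrix.mul_neg,
    Matrix.mul_neg, Matrix.mul_one]
  abel

theorem Qhat_col_succ_of_recursion (hu : ∀ k, IsUnit (D.Psi k)) {h c : ℕ → Matrix γ β ℝ} {i : ℕ}
    (h0 : h i = h (i + 1) * D.R (i + 1) + c i * D.N i)
    (h1 : h (i + 1) = h (i + 2) * D.R (i + 2) + c (i + 1) * D.N (i + 1)) :
    h i * D.A0 (i + 1) + (h (i + 1) * D.A1 (i + 2) + h (i + 2) * D.A2 (i + 3))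
      = c i * D.G i - c (i + 1) := by
  have h2 : h (i + 1) * D.Psi (i + 1) = -(h (i + 2) * D.A2 (i + 3)) - c (i + 1) := by
    rw [h1, Matrix.add_mul, Matrix.mul_assoc, Matrix.mul_assoc, R_mul_Psi (hu _),
      N_mul_Psi (hu _), Matrix.mul_neg, Matrix.mul_neg, Matrix.mul_one]
    abel
  rw [h0, Matrix.add_mul, Matrix.mul_assoc, Matrix.mul_assoc, ← G_eq]
  rw [← R_mul_A0_add, Matrix.mul_add] at h2
  rw [← sub_eq_zero] at h2 ⊢
  rw [← h2]
  abel

theorem recursion_of_Qhat_col (hu : ∀ k, IsUnit (D.Psi k)) {h c : ℕ → Matrix γ β ℝ}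
    (h0 : h 0 * D.A1 1 + h 1 * D.A2 2 = -c 0)
    (hs : ∀ i, h i * D.A0 (i + 1) + (h (i + 1) * D.A1 (i + 2) + h (i + 2) * D.A2 (i + 3))
      = c i * D.G i - c (i + 1)) (i : ℕ) :
    h i = h (i + 1) * D.R (i + 1) + c i * D.N i := by
  have key : ∀ i, h i * D.Psi i = -(h (i + 1) * D.A2 (i + 2)) - c i →
      h i = h (i + 1) * D.R (i + 1) + c i * D.N i := by
    intro i hi
    have h1 := congrArg (fun M => M * D.N i) hi
    simp only [Matrix.mul_assoc, Psi_mul_N (hu i), Matrix.mul_neg, Matrix.mul_one,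
      Matrix.sub_mul, Matrix.neg_mul, ← R_succ_eq] at h1
    rw [← neg_inj, h1]
    abel
  induction i with
  | zero => exact key 0 (by rw [Psi, eq_sub_of_add_eq h0]; abel)
  | succ i ih =>
    refine key _ ?_
    have h1 := hs i
    rw [ih, Matrix.add_mul, Matrix.mul_assoc, Matrix.mul_assoc, ← G_eq] at h1
    rw [← R_mul_A0_add, Matrix.mul_add]
    rw [← sub_eq_zero] at h1 ⊢
    rw [← h1]
    abel

theorem recursion_iterate_row {h c : ℕ → Matrix γ β ℝ}
    (hr : ∀ i, h i = h (i + 1) * D.R (i + 1) + c i * D.N i) {i n : ℕ} (hin : i ≤ n) :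
    h i = ∑ k ∈ Finset.range n, c k * D.N k * D.Xb k i + h n * D.Xb n i := by
  induction n, hin using Nat.le_induction with
  | base =>
    rw [Finset.sum_eq_zero fun k hk => by
      rw [D.Xb_eq_zero (Finset.mem_range.1 hk), Matrix.mul_zero]]
    simp
  | succ n hn ih =>
    rw [Finset.sum_range_succ, Xb_succ _ hn]
    conv_lhs => rw [ih, hr n]
    rw [Matrix.add_mul, ← Matrix.mul_assoc]
    abel

end Potential

variable (D) in
/-- The `k`-th term of block `(i, j)` of the minimal nonnegative inverse of `-Q̂`. -/
noncomputable def potentialTerm (i j k : ℕ) : Matrix β β ℝ := D.Yb i k * D.N k * D.Xb k j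

/-- Applying `I - 𝔾_U` on the left kills every term of the series except `k = i`. -/
theorem potentialTerm_eq_col (i j k : ℕ) : D.potentialTerm i j k
    = D.G i * D.potentialTerm (i + 1) j k + D.N i * if i = k then D.Xb i j else 0 := by
  rw [potentialTerm, D.Yb_eq i k, potentialTerm]
  split_ifs with h
  · subst h; simp [add_mul, mul_assoc, add_comm]
  · simp [mul_assoc]

theorem potentialTerm_eq_row (i j k : ℕ) : D.potentialTerm i j k
    = D.potentialTerm i (j + 1) k * D.R (j + 1) + (if j = k then D.Yb i j else 0) * D.N j := by
  rw [potentialTerm, D.Xb_eq k j, potentialTerm]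
  by_cases h : j = k
  · subst h; simp [mul_add, mul_assoc, add_comm]
  · simp [h, Ne.symm h, mul_assoc]

/-! ### Convergence of the potential series -/

section Stationary

variable [Fintype α]

/-- The row block of `x` at level `i + 1`. -/
def levelVec (x : α ⊕ ℕ × β → ℝ) (i : ℕ) : Matrix Unit β ℝ := fun _ b => x (Sum.inr (i, b))

variable (D) in
/-- The row vector `x_0 A_0^{(0)}`. -/
def inflow (x : α ⊕ ℕ × β → ℝ) : Matrix Unit β ℝ := fun _ b => ∑ a, x (Sum.inl a) * D.B0 a b

/-- On positive levels `x` solves `x Q̂ = -(x_0 A_0^{(0)}, 0, …)`. The choice `c_i = x_0 A_0^{(0)}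
Yb 0 i` is the one with `c (I - 𝔾_U) = (x_0 A_0^{(0)}, 0, …)`. -/
theorem levelVec_recursion (hu : ∀ k, IsUnit (D.Psi k)) {x : α ⊕ ℕ × β → ℝ}
    (hx : IsStationaryProb D.generator x) (i : ℕ) :
    levelVec x i = levelVec x (i + 1) * D.R (i + 1) + D.inflow x * D.Yb 0 i * D.N i := by
  refine recursion_of_Qhat_col hu (c := fun i => D.inflow x * D.Yb 0 i) ?_ (fun i => ?_) i
  · ext _ b
    have := (D.hasSum_generator_col_zero b x).unique (hx.2.2 _)
    simp only [Yb_self, Matrix.mul_one, Matrix.add_apply, Matrix.neg_apply, Matrix.mul_apply,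
      levelVec, inflow, Pi.zero_apply] at this ⊢
    linarith
  · rw [Yb_succ _ (Nat.zero_le i), Matrix.mul_assoc, sub_self]
    ext _ b
    exact (D.hasSum_generator_col_succ i b x).unique (hx.2.2 _)

variable [Nonempty α]

theorem potentialTerm_nonneg (h : IsGenerator D.generator)
    (hirr : IsIrreducibleGenerator D.generator) (i j k : ℕ) :
    EntrywiseNonneg (D.potentialTerm i j k) :=
  ((Yb_nonneg h hirr i k).mul (N_nonneg h hirr k)).mul (Xb_nonneg h hirr k j)

omit [Fintype β] [DecidableEq β] [Nonempty α] in
theorem inflow_nonneg (h : IsGenerator D.generator) {x : α ⊕ ℕ × β → ℝ}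
    (hx : IsStationaryProb D.generator x) : EntrywiseNonneg (D.inflow x) := fun _ b =>
  Finset.sum_nonneg fun a _ => mul_nonneg (hx.1 _) (B0_nonneg h a b)

theorem sum_inflow_mul_potentialTerm_le (h : IsGenerator D.generator)
    (hirr : IsIrreducibleGenerator D.generator) {x : α ⊕ ℕ × β → ℝ}
    (hx : IsStationaryProb D.generator x) (j n : ℕ) (b : β) :
    ∑ k ∈ Finset.range n, (D.inflow x * D.potentialTerm 0 j k) () b ≤ x (Sum.inr (j, b)) := by
  have hnn : ∀ k, 0 ≤ (D.inflow x * D.potentialTerm 0 j k) () b := fun k =>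
    ((inflow_nonneg h hx).mul (potentialTerm_nonneg h hirr 0 j k)) () b
  refine (Finset.sum_le_sum_of_subset_of_nonneg
    -- The iteration only starts at index `j`, hence the passage to `max n j`; its remainder is
    -- nonnegative and is dropped.
    (Finset.range_mono (le_max_left n j)) fun k _ _ => hnn k).trans ?_
  have h1 := recursion_iterate_row (levelVec_recursion (isUnit_Psi h hirr) hx) (le_max_right n j)
  have h2 := congrFun (congrFun h1 ()) b
  have h3 : 0 ≤ (levelVec x (max n j) * D.Xb (max n j) j) () b :=
    EntrywiseNonneg.mul (fun _ b => hx.1 _) (Xb_nonneg h hirr _ _) () b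
  rw [Matrix.add_apply, Matrix.sum_apply] at h2
  simp only [potentialTerm, ← Matrix.mul_assoc]
  change x (Sum.inr (j, b)) = _ at h2
  linarith

/-- States entered directly from level `0` have positive inflow, so the bound by `x` gives
convergence there. Along a transition from `s` to `t` between positive levels, each late term at `t`
is at most a constant times the term at `s`. A path from level `0` reaches every state. -/
theorem summable_potentialTerm (h : IsGenerator D.generator)
    (hirr : IsIrreducibleGenerator D.generator) {x : α ⊕ ℕ × β → ℝ}
    (hx : IsStationaryProb D.generator x) (i j : ℕ) (a b : β) :
    Summable fun k => D.potentialTerm i j k a b := by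
  have hnn := fun i k a => potentialTerm_nonneg h hirr i j k a b
  have hu := isUnit_Psi h hirr
  suffices key : ∀ s : α ⊕ ℕ × β, ∀ i a, s = Sum.inr (i, a) →
      Summable fun k => D.potentialTerm i j k a b from key _ i a rfl
  intro s
  have hpath := hirr (Sum.inl (Classical.arbitrary α)) s
  induction hpath with
  | refl => intro i a hia; cases hia
  | @tail s t _ hst ih =>
    rintro i a rfl
    rcases s with a' | ⟨i', a'⟩
    · rw [generator_inl_inr] at hst
      split_ifs at hst with hi
      · subst hi
        have hpos : 0 < D.inflow x () a := by
          refine lt_of_lt_of_le (mul_pos (stationary_pos h hirr hx (Sum.inl a')) hst) ?_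
          exact Finset.single_le_sum (f := fun a' => x (Sum.inl a') * D.B0 a' a)
            (fun c _ => mul_nonneg (hx.1 _) (B0_nonneg h c a)) (Finset.mem_univ a')
        refine (summable_mul_left_iff hpos.ne').1 ?_
        refine summable_of_sum_range_le (c := x (Sum.inr (j, b)))
          (fun k => mul_nonneg hpos.le (hnn 0 k a)) fun n => ?_
        refine le_trans ?_ (sum_inflow_mul_potentialTerm_le h hirr hx j n b)
        refine Finset.sum_le_sum fun k _ => ?_
        exact Finset.single_le_sum (f := fun a => D.inflow x () a * D.potentialTerm 0 j k a b)
          (fun c _ => mul_nonneg (inflow_nonneg h hx () c) (hnn 0 k c)) (Finset.mem_univ a)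
      · exact absurd hst (lt_irrefl _)
    · by_cases hne : (i', a') = (i, a)
      · cases hne; exact ih _ _ rfl
      have hs := ih i' a' rfl
      refine (summable_mul_left_iff hst.ne').1 ?_
      -- `-Q̂ h = 0` at level `i'` for the terms with a large index
      refine Summable.of_norm_bounded_eventually_nat
        (hs.mul_left (-D.generator (Sum.inr (i', a')) (Sum.inr (i', a')))) ?_
      filter_upwards [Filter.eventually_gt_atTop i'] with k hk
      let u : α ⊕ ℕ × β → ℝ := Sum.elim (fun _ => 0) fun p => D.potentialTerm p.1 j k p.2 b
      have hrec : ∀ l, D.potentialTerm l j k = D.G l * D.potentialTerm (l + 1) j k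
          + D.N l * if l = k then D.Xb l j else 0 := fun l => potentialTerm_eq_col l j k
      have hsum : HasSum (fun t => D.generator (Sum.inr (i', a')) t * u t) 0 := by
        rcases i' with _ | i'
        · convert D.hasSum_generator_row_zero a' u using 1
          have h1 := congrFun (congrFun (Qhat_row_zero_of_recursion hu
            (h := fun l => D.potentialTerm l j k) (c := fun l => if l = k then D.Xb l j else 0) (hrec 0)) a') b
          simp only [hk.ne, if_false, neg_zero] at h1
          rw [show ∑ a, D.B2 a' a * u (Sum.inl a) = 0 by simp [u], zero_add]
          exact h1.symm
        · convert D.hasSum_generator_row_succ i' a' u using 1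
          have h1 := congrFun (congrFun (Qhat_row_succ_of_recursion hu
            (h := fun l => D.potentialTerm l j k) (c := fun l => if l = k then D.Xb l j else 0) (hrec i') (hrec (i' + 1))) a') b
          simp only [hk.ne, show i' ≠ k by lia, if_false, mul_zero, sub_zero] at h1
          exact h1.symm
      classical
      -- Off the diagonal all terms of the row equation are nonnegative, so the single term at `(i,
      -- a)` is at most minus the diagonal one.
      have h2 := le_hasSum (hsum.update (Sum.inr (i', a')) 0) (Sum.inr (i, a)) fun t _ => by
        by_cases ht : t = Sum.inr (i', a')
        · subst ht; simp
        · rw [Function.update_of_ne ht]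
          refine mul_nonneg (h.1 _ _ (Ne.symm ht)) ?_
          rcases t with c | ⟨l, c⟩
          · exact le_rfl
          · exact hnn l k c
      rw [Function.update_of_ne (by simpa [eq_comm] using hne)] at h2
      rw [Real.norm_of_nonneg (mul_nonneg hst.le (hnn i k a))]
      simp only [u, Sum.elim_inr] at h2
      linarith

end Stationary

/-! ### The potential as maximal non-positive inverse -/

section QhatProducts

omit [Fintype β] [DecidableEq β] in
theorem blockMatrix_injective {F H : ℕ → ℕ → Matrix β β ℝ} (h : blockMatrix F = blockMatrix H)
    (i j : ℕ) : F i j = H i j := by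
  ext a b
  exact congrFun (congrFun h (i, a)) (j, b)

variable (D) in
/-- The blocks of `Q̂ H`. -/
def QhatMul (H : ℕ → ℕ → Matrix β β ℝ) : ℕ → ℕ → Matrix β β ℝ
  | 0, k => D.A1 1 * H 0 k + D.A0 1 * H 1 k
  | i + 1, k => D.A2 (i + 2) * H i k + (D.A1 (i + 2) * H (i + 1) k + D.A0 (i + 2) * H (i + 2) k)

variable (D) in
/-- The blocks of `H Q̂`. -/
def mulQhat (H : ℕ → ℕ → Matrix β β ℝ) : ℕ → ℕ → Matrix β β ℝ
  | i, 0 => H i 0 * D.A1 1 + H i 1 * D.A2 2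
  | i, k + 1 =>
    H i k * D.A0 (k + 1) + (H i (k + 1) * D.A1 (k + 2) + H i (k + 2) * D.A2 (k + 3))

omit [DecidableEq β] in
theorem hasMatMul_Qhat_left (H : ℕ → ℕ → Matrix β β ℝ) :
    HasMatMul D.Qhat (blockMatrix H) (blockMatrix (D.QhatMul H)) := by
  rw [Qhat_eq]
  refine hasMatMul_blockMatrix fun i k => ?_
  rcases i with _ | i
  · refine ⟨{0, 1}, fun j hj => Or.inl ?_, ?_⟩
    · simp only [Finset.mem_insert, Finset.mem_singleton, not_or] at hj
      exact QhatBlock_eq_zero _ (by lia) (by lia) (by lia)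
    · rw [Finset.sum_pair (by simp)]
      simp [QhatMul]
  · refine ⟨{i, i + 1, i + 2}, fun j hj => Or.inl ?_, ?_⟩
    · simp only [Finset.mem_insert, Finset.mem_singleton, not_or] at hj
      exact QhatBlock_eq_zero _ (by lia) (by lia) (by lia)
    · rw [Finset.sum_insert (by simp), Finset.sum_pair (by simp)]
      simp [QhatMul]

omit [DecidableEq β] in
theorem hasMatMul_Qhat_right (H : ℕ → ℕ → Matrix β β ℝ) :
    HasMatMul (blockMatrix H) D.Qhat (blockMatrix (D.mulQhat H)) := by
  rw [Qhat_eq]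
  refine hasMatMul_blockMatrix fun i k => ?_
  rcases k with _ | k
  · refine ⟨{0, 1}, fun j hj => Or.inr ?_, ?_⟩
    · simp only [Finset.mem_insert, Finset.mem_singleton, not_or] at hj
      exact QhatBlock_eq_zero _ (by lia) (by lia) (by lia)
    · rw [Finset.sum_pair (by simp)]
      simp [mulQhat]
  · refine ⟨{k, k + 1, k + 2}, fun j hj => Or.inr ?_, ?_⟩
    · simp only [Finset.mem_insert, Finset.mem_singleton, not_or] at hj
      exact QhatBlock_eq_zero _ (by lia) (by lia) (by lia)
    · rw [Finset.sum_insert (by simp), Finset.sum_pair (by simp)]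
      simp [mulQhat]

end QhatProducts

variable (D) in
/-- Block `(i, j)` of the minimal nonnegative inverse of `-Q̂`. -/
noncomputable def potential (i j : ℕ) : Matrix β β ℝ := fun a b => ∑' k, D.potentialTerm i j k a b

variable (D) in
/-- The maximal non-positive inverse of `Q̂`. -/
noncomputable def Qinv : Matrix (ℕ × β) (ℕ × β) ℝ := blockMatrix fun i j => -D.potential i j

section Inverse

variable (hs : ∀ i j a b, Summable fun k => D.potentialTerm i j k a b)
include hs

theorem hasSum_potentialTerm (i j : ℕ) :
    HasSum (fun k => D.potentialTerm i j k) (D.potential i j) :=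
  Pi.hasSum.2 fun a => Pi.hasSum.2 fun b => (hs i j a b).hasSum

theorem potential_eq_col (i j : ℕ) :
    D.potential i j = D.G i * D.potential (i + 1) j + D.N i * D.Xb i j := by
  refine (hasSum_potentialTerm hs i j).unique ?_
  have h1 : HasSum (fun k => if i = k then D.Xb i j else 0) (D.Xb i j) := by
    simpa [eq_comm] using hasSum_ite_eq i (D.Xb i j)
  have h2 := ((hasSum_potentialTerm hs (i + 1) j).mul_left (D.G i)).add (h1.mul_left (D.N i))
  exact h2.congr_fun fun k => potentialTerm_eq_col i j k

theorem potential_eq_row (i j : ℕ) :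
    D.potential i j = D.potential i (j + 1) * D.R (j + 1) + D.Yb i j * D.N j := by
  refine (hasSum_potentialTerm hs i j).unique ?_
  have h1 : HasSum (fun k => if j = k then D.Yb i j else 0) (D.Yb i j) := by
    simpa [eq_comm] using hasSum_ite_eq j (D.Yb i j)
  have h2 := ((hasSum_potentialTerm hs i (j + 1)).mul_right (D.R (j + 1))).add
    (h1.mul_right (D.N j))
  exact h2.congr_fun fun k => potentialTerm_eq_row i j k

/-- The recursions hold with `c = Xb · j` and `c = Yb i ·`, for which `(I - ℝ_L) c` and `c (I -
𝔾_U)` are a unit block column and row. -/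
theorem Qinv_isMatInverse (hu : ∀ k, IsUnit (D.Psi k)) : IsMatInverse D.Qhat D.Qinv := by
  rw [IsMatInverse, one_eq_blockMatrix]
  constructor
  · suffices hK : D.QhatMul (fun i j => -D.potential i j) = fun i j => if i = j then 1 else 0 by
      rw [← hK]; exact hasMatMul_Qhat_left _
    funext i j
    rcases i with _ | i
    · have h1 := Qhat_row_zero_of_recursion hu (h := fun i => D.potential i j)
        (c := fun i => D.Xb i j) (potential_eq_col hs 0 j)
      rw [Xb_zero_left] at h1
      simp only [QhatMul, mul_neg, ← neg_add, h1, neg_neg]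
    · have h1 := Qhat_row_succ_of_recursion hu (h := fun i => D.potential i j)
        (c := fun i => D.Xb i j) (potential_eq_col hs i j) (potential_eq_col hs (i + 1) j)
      rw [Xb_succ_eq] at h1
      simp only [QhatMul, mul_neg, ← neg_add, h1]
      abel
  · suffices hK : D.mulQhat (fun i j => -D.potential i j) = fun i j => if i = j then 1 else 0 by
      rw [← hK]; exact hasMatMul_Qhat_right _
    funext i j
    rcases j with _ | j
    · have h1 := Qhat_col_zero_of_recursion hu (h := fun j => D.potential i j)
        (c := fun j => D.Yb i j) (potential_eq_row hs i 0)
      rw [Yb_zero_right] at h1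
      simp only [mulQhat, neg_mul, ← neg_add, h1, neg_neg]
    · have h1 := Qhat_col_succ_of_recursion hu (h := fun j => D.potential i j)
        (c := fun j => D.Yb i j) (potential_eq_row hs i j) (potential_eq_row hs i (j + 1))
      rw [Yb_succ_eq] at h1
      simp only [mulQhat, neg_mul, ← neg_add, h1]
      abel

variable [Fintype α] [Nonempty α] (h : IsGenerator D.generator)
  (hirr : IsIrreducibleGenerator D.generator)
include h hirr

/-- The maximal non-positive inverse of `Q̂` is the product of the inverses of its factors. -/
theorem Qinv_factorization : HasMatMul₃ D.GUinv D.UDinv D.RLinv D.Qinv := by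
  refine ⟨blockMatrix fun i k => D.Yb i k * (D.Psi k)⁻¹, ?_, ?_⟩
  · rw [GUinv_eq, UDinv]
    refine hasMatMul_blockMatrix fun i k => ⟨{k}, fun j hj => Or.inr ?_, by simp⟩
    simp only [Finset.mem_singleton] at hj
    simp [hj]
  · rintro ⟨i, a⟩ ⟨j, b⟩
    let f : ℕ × β → ℝ := fun p => (D.Yb i p.1 * D.N p.1) a p.2 * D.Xb p.1 j p.2 b
    have hf : 0 ≤ f := fun p => mul_nonneg
      (((Yb_nonneg h hirr i p.1).mul (N_nonneg h hirr p.1)) a p.2) (Xb_nonneg h hirr p.1 j p.2 b)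
    have hfib : ∀ k, HasSum (fun c => f (k, c)) (D.potentialTerm i j k a b) := fun k =>
      hasSum_fintype _
    -- The terms are nonnegative, so convergence of the sum over blocks `k` of the finite inner sums
    -- gives convergence over all pairs.
    have hsum : Summable f := (summable_prod_of_nonneg hf).2 ⟨fun k => (hfib k).summable, by
      simpa only [(hfib _).tsum_eq] using hs i j a b⟩
    have h1 : HasSum f (D.potential i j a b) := by
      have h2 := (hsum.hasSum.prod_fiberwise hfib).unique (hs i j a b).hasSum
      rw [potential, ← h2]
      exact hsum.hasSum
    refine h1.neg.congr_fun fun p => ?_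
    simp [f, N, blockMatrix, RLinv_eq]

/-- For a non-positive inverse `W`, the columns of `-W` obey the recursion of the potential.
Iterating it writes `-W` as a partial sum of the series plus a nonnegative remainder, so `-W`
dominates the potential. -/
theorem Qinv_isMaxNonposInverse : IsMaxNonposInverse D.Qhat D.Qinv := by
  have hu := isUnit_Psi h hirr
  refine ⟨Qinv_isMatInverse hs hu, fun ⟨i, a⟩ ⟨j, b⟩ => ?_, ?_⟩
  · exact neg_nonpos.2 (tsum_nonneg fun k => potentialTerm_nonneg h hirr i j k a b)
  · rintro W hW hW0 ⟨i, a⟩ ⟨j, b⟩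
    let H : ℕ → ℕ → Matrix β β ℝ := fun i j a b => W (i, a) (j, b)
    have hWH : W = blockMatrix H := rfl
    have h1 : blockMatrix (D.QhatMul H) = (1 : Matrix (ℕ × β) (ℕ × β) ℝ) := by
      ext p q
      exact (D.hasMatMul_Qhat_left H p q).unique (hW.1 p q)
    rw [one_eq_blockMatrix] at h1
    have h2 := fun i => blockMatrix_injective h1 i j
    have hrec := recursion_of_Qhat_row hu (h := fun i => -H i j) (c := fun i => D.Xb i j)
      (by
        have h3 := h2 0
        simp only [QhatMul] at h3
        rw [Xb_zero_left, ← h3, mul_neg, mul_neg]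
        abel)
      (fun i => by
        have h3 := h2 (i + 1)
        simp only [QhatMul] at h3
        rw [Xb_succ_eq, ← h3, mul_neg, mul_neg, mul_neg]
        abel)
    refine le_neg_of_le_neg ?_
    refine Real.tsum_le_of_sum_range_le
      (fun k => potentialTerm_nonneg h hirr i j k a b) fun n => ?_
    refine (Finset.sum_le_sum_of_subset_of_nonneg (Finset.range_mono (le_max_left n i))
      fun k _ _ => potentialTerm_nonneg h hirr i j k a b).trans ?_
    have h4 := congrFun (congrFun (recursion_iterate_col hrec (le_max_right n i)) a) b
    have h5 : 0 ≤ (D.Yb i (max n i) * -H (max n i) j) a b :=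
      (Yb_nonneg h hirr _ _).mul (fun c d => neg_nonneg.2 (hW0 (_, c) (_, d))) a b
    rw [Matrix.add_apply, Matrix.sum_apply] at h4
    change -W (i, a) (j, b) = _ at h4
    simp only [potentialTerm]
    linarith

end Inverse

/-! ### Tail sums and the block shift -/

section Tail

variable {x : α ⊕ ℕ × β → ℝ}

omit [Fintype β] [DecidableEq β] in
theorem summable_level (hx : IsStationaryProb D.generator x) (i : ℕ) (b : β) :
    Summable fun j : ℕ => x (Sum.inr (i + j, b)) := by
  refine hx.2.1.summable.comp_injective (i := fun j : ℕ => Sum.inr (i + j, b)) fun j k hjk => ?_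
  simpa using hjk

omit [Fintype β] [DecidableEq β] in
theorem tail_sub_tail_succ (hx : IsStationaryProb D.generator x) (i : ℕ) (b : β) :
    tail x (i, b) - tail x (i + 1, b) = x (Sum.inr (i, b)) := by
  have h1 : tail x (i, b) = _ := (summable_level hx i b).tsum_eq_zero_add
  have h2 : tail x (i + 1, b) = ∑' j : ℕ, x (Sum.inr (i + (j + 1), b)) :=
    tsum_congr fun j => by rw [show i + (j + 1) = i + 1 + j by ring]
  rw [h1, h2, add_sub_cancel_right, add_zero]

omit [DecidableEq β] in
-- Summation by parts: row `i + 1` of `ℚ` is row `i` of `Q̂`, so the left side is `∑ (π_i - π_{i+1})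
-- Q̂_i`, that is `x Q̂` on positive levels, and stationarity evaluates it.
theorem tail_mul_Qhat_sub_shiftedQhat [Fintype α] (hx : IsStationaryProb D.generator x) :
    HasVecMul (tail x) (D.Qhat - D.shiftedQhat) (D.boundaryVec x) := by
  rintro ⟨q, c⟩
  have h0 : ∀ i, q + 1 < i → D.QhatBlock i q = 0 := fun i hi =>
    QhatBlock_eq_zero _ (by lia) (by lia) (by lia)
  have h1 := hasSum_prod_of_finset (f := fun p => tail x p * D.Qhat p (q, c))
    (Finset.range (q + 2)) fun i hi b => by
      simp only [Finset.mem_range, not_lt] at hi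
      simp [Qhat_eq, blockMatrix, h0 i (by lia)]
  have h2 := hasSum_prod_of_finset (f := fun p => tail x p * D.shiftedQhat p (q, c))
    (Finset.range (q + 2 + 1)) fun i hi b => by
      simp only [Finset.mem_range, not_lt] at hi
      obtain ⟨i, rfl⟩ : ∃ k, i = k + 1 := ⟨i - 1, by lia⟩
      simp [shiftedQhat, Qhat_eq, blockMatrix, h0 i (by lia)]
  have h3 := hasSum_sum_prod_of_finset
    (f := fun s => x s * D.generator s (Sum.inr (q, c)))
    (Finset.range (q + 2)) fun i hi b => by
      simp only [Finset.mem_range, not_lt] at hi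
      simp [h0 i (by lia)]
  have h4 := h3.unique (hx.2.2 _)
  have h5 : HasSum (fun p => tail x p * (D.Qhat - D.shiftedQhat) p (q, c)) _ :=
    (h1.sub h2).congr_fun fun p => by rw [Matrix.sub_apply, mul_sub]
  -- The range for `ℚ` is one longer; splitting off its zero first row aligns it with that of `Q̂`.
  rw [Finset.sum_range_succ' _ (q + 2)] at h5
  have h7 : ∀ b, D.shiftedQhat (0, b) (q, c) = 0 := fun b => rfl
  have h8 : ∀ i b, D.shiftedQhat (i + 1, b) (q, c) = D.Qhat (i, b) (q, c) := fun i b => rfl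
  simp only [h7, h8, mul_zero, Finset.sum_const_zero, add_zero,
    ← Finset.sum_sub_distrib, ← sub_mul, tail_sub_tail_succ hx] at h5
  have h6 : D.boundaryVec x (q, c)
      = -∑ a, x (Sum.inl a) * D.generator (Sum.inl a) (Sum.inr (q, c)) := by
    simp only [boundaryVec, generator_inl_inr, Matrix.vecMul, dotProduct]
    split_ifs <;> simp
  rw [h6, ← eq_neg_of_add_eq_zero_right h4]
  exact h5

theorem sum_mul_one_apply (v : β → ℝ) (b : β) :
    ∑ a, v a * (1 : Matrix β β ℝ) a b = v b := by
  simp [Matrix.one_apply]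

theorem tail_mul_one_sub_shift (hx : IsStationaryProb D.generator x) :
    HasVecMul (tail x) (1 - blockMatrix fun i j => if i = j + 1 then 1 else 0)
      (fun p => x (Sum.inr p)) := by
  rintro ⟨j, b⟩
  rw [one_eq_blockMatrix, blockMatrix_sub]
  have h1 := hasSum_prod_of_finset (f := fun p => tail x p * blockMatrix (fun i j =>
    (if i = j then 1 else 0) - if i = j + 1 then (1 : Matrix β β ℝ) else 0) p (j, b)) {j, j + 1}
    fun i hi c => by
      simp only [Finset.mem_insert, Finset.mem_singleton, not_or] at hi
      simp [blockMatrix, hi.1, hi.2]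
  rw [Finset.sum_pair (by simp)] at h1
  convert h1 using 1
  simp [blockMatrix, sum_mul_one_apply (fun c => tail x (j, c)),
    sum_mul_one_apply (fun c => tail x (j + 1, c)), ← tail_sub_tail_succ hx, sub_eq_add_neg]

omit [Fintype β] in
theorem level_mul_lowerOnes (hx : IsStationaryProb D.generator x) :
    HasVecMul (fun p => x (Sum.inr p)) (blockMatrix fun i j => if j ≤ i then 1 else 0)
      (tail x) := by
  rintro ⟨j, b⟩
  have hinj : Function.Injective fun l : ℕ => ((j + l, b) : ℕ × β) := fun l k hlk => by
    simpa using hlk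
  refine (hinj.hasSum_iff ?_).1 ?_
  · rintro ⟨i, c⟩ hi
    by_cases hji : j ≤ i
    · by_cases hcb : c = b
      · subst hcb
        exact absurd ⟨i - j, by simp [hji]⟩ hi
      · simp [blockMatrix, hji, hcb]
    · simp [blockMatrix, hji]
  · refine (summable_level hx j b).hasSum.congr_fun fun l => ?_
    simp [blockMatrix]

end Tail

theorem hasPowerSum_shift :
    HasPowerSum (blockMatrix fun i j => if i = j + 1 then (1 : Matrix β β ℝ) else 0)
      (blockMatrix fun i j => if j ≤ i then 1 else 0) := by
  refine ⟨fun k => blockMatrix fun i j => if i = j + k then 1 else 0, ?_, fun k => ?_, ?_⟩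
  · simp [one_eq_blockMatrix]
  · refine hasMatMul_blockMatrix fun i j => ⟨{j + 1}, fun l hl => Or.inr ?_, ?_⟩
    · simp only [Finset.mem_singleton] at hl
      simp [hl]
    · simp [show j + 1 + k = j + (k + 1) by ring]
  · rintro ⟨i, a⟩ ⟨j, b⟩
    by_cases hji : j ≤ i
    · convert hasSum_single (f := fun k => blockMatrix (fun i j =>
        if i = j + k then (1 : Matrix β β ℝ) else 0) (i, a) (j, b)) (i - j) ?_ using 1
      · simp [blockMatrix, hji]
      · intro k hk
        simp [blockMatrix, show i ≠ j + k by lia]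
    · convert hasSum_zero using 2 with k
      · simp [blockMatrix, show i ≠ j + k by lia]
      · simp [blockMatrix, hji]

omit [Fintype β] in
theorem shiftedQhat_mul_inverse {V : Matrix (ℕ × β) (ℕ × β) ℝ} (hV : HasMatMul D.Qhat V 1) :
    HasMatMul D.shiftedQhat V (blockMatrix fun i j => if i = j + 1 then 1 else 0) := by
  rintro ⟨i, a⟩ ⟨j, b⟩
  rcases i with _ | i
  · simp [shiftedQhat, blockMatrix]
  · have h1 := hV (i, a) (j, b)
    rw [one_eq_blockMatrix] at h1
    simpa [blockMatrix, shiftedQhat] using h1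

/-! ### Identification of the stationary vector through recurrence -/

section Recurrence

variable [Fintype α] [DecidableEq α] [Nonempty α] {x : α ⊕ ℕ × β → ℝ}

/-- The partial sums give only `≤`; the limit of the remainder is not computed. Instead the left
side, with `x_0` on level `0`, is compared with `x` by uniqueness of subinvariant measures. -/
theorem inflow_mul_potential (h : IsGenerator D.generator)
    (hirr : IsIrreducibleGenerator D.generator) (hrec : IsPositiveRecurrent D.generator)
    (hx : IsStationaryProb D.generator x) (j : ℕ) (b : β) :
    (D.inflow x * D.potential 0 j) () b = x (Sum.inr (j, b)) := by
  have hs := summable_potentialTerm h hirr hx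
  have hu := isUnit_Psi h hirr
  let a₀ : α := Classical.arbitrary α
  have : Nontrivial (α ⊕ ℕ × β) := ⟨⟨Sum.inl a₀, Sum.inr (j, b), by simp⟩⟩
  have hdiag := diag_neg h hirr
  have hret := ((hrec (Sum.inl a₀)).resolve_left (hdiag _).ne).1
  have hle : ∀ j b, (D.inflow x * D.potential 0 j) () b ≤ x (Sum.inr (j, b)) := fun j b => by
    have h1 : HasSum (fun k => (D.inflow x * D.potentialTerm 0 j k) () b)
        ((D.inflow x * D.potential 0 j) () b) :=
      hasSum_sum fun a _ => (hs 0 j a b).hasSum.mul_left _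
    rw [← h1.tsum_eq]
    exact Real.tsum_le_of_sum_range_le
      (fun k => ((inflow_nonneg h hx).mul (potentialTerm_nonneg h hirr 0 j k)) () b)
      fun n => sum_inflow_mul_potentialTerm_le h hirr hx j n b
  have hnn : ∀ j, EntrywiseNonneg (D.inflow x * D.potential 0 j) := fun j =>
    (inflow_nonneg h hx).mul fun a b => tsum_nonneg fun k => potentialTerm_nonneg h hirr 0 j k a b
  have hr : ∀ i, D.inflow x * D.potential 0 i = D.inflow x * D.potential 0 (i + 1) * D.R (i + 1)
      + D.inflow x * D.Yb 0 i * D.N i := fun i => by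
    rw [potential_eq_row hs, Matrix.mul_add, Matrix.mul_assoc, Matrix.mul_assoc]
  let m : α ⊕ ℕ × β → ℝ := Sum.elim (fun a => x (Sum.inl a))
    fun p => (D.inflow x * D.potential 0 p.1) () p.2
  refine eq_of_subinvariant (m := m) (i := Sum.inl a₀) h hirr hdiag hret ?_ hx.1 ?_
    (fun s => ⟨0, le_rfl, hx.2.2 s⟩) rfl (Sum.inr (j, b))
  · rintro (a | ⟨i, c⟩)
    · exact hx.1 _
    · exact hnn i () c
  -- Columns of positive levels vanish exactly by the potential recursion. In level `0` only an
  -- inequality is available, from `m ≤ x` and `B2 ≥ 0`, which is why subinvariance is the right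
  -- notion.
  · rintro (a | ⟨_ | i, c⟩)
    · refine ⟨_, ?_, D.hasSum_generator_col_inl a m⟩
      refine le_of_le_of_eq (add_le_add le_rfl (Finset.sum_le_sum fun c _ => ?_))
        ((D.hasSum_generator_col_inl a x).unique (hx.2.2 _))
      exact mul_le_mul_of_nonneg_right (hle 0 c) (B2_nonneg h c a)
    · refine ⟨_, ?_, D.hasSum_generator_col_zero c m⟩
      have h1 := congrFun (congrFun (Qhat_col_zero_of_recursion hu
        (h := fun i => D.inflow x * D.potential 0 i) (c := fun i => D.inflow x * D.Yb 0 i)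
        (hr 0)) ()) c
      simp only [Yb_self, Matrix.mul_one, Matrix.add_apply, Matrix.neg_apply] at h1
      rw [eq_neg_iff_add_eq_zero, add_comm] at h1
      exact le_of_eq h1
    · refine ⟨_, ?_, D.hasSum_generator_col_succ i c m⟩
      have h1 := congrFun (congrFun (Qhat_col_succ_of_recursion hu
        (h := fun i => D.inflow x * D.potential 0 i) (c := fun i => D.inflow x * D.Yb 0 i)
        (hr i) (hr (i + 1))) ()) c
      rw [Yb_succ _ (Nat.zero_le i), ← Matrix.mul_assoc (D.inflow x) (D.Yb 0 i), sub_self] at h1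
      exact le_of_eq h1

theorem boundaryVec_mul_Qinv (h : IsGenerator D.generator)
    (hirr : IsIrreducibleGenerator D.generator) (hrec : IsPositiveRecurrent D.generator)
    (hx : IsStationaryProb D.generator x) :
    HasVecMul (D.boundaryVec x) D.Qinv (fun p => x (Sum.inr p)) := by
  rintro ⟨j, b⟩
  have h1 := hasSum_prod_of_finset (f := fun p => D.boundaryVec x p * D.Qinv p (j, b)) {0}
    fun i hi c => by
      simp only [Finset.mem_singleton] at hi
      simp [boundaryVec, hi]
  convert h1 using 1
  simp only [← inflow_mul_potential h hirr hrec hx, Finset.sum_singleton, boundaryVec, if_true,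
    Qinv, blockMatrix, Matrix.neg_apply, neg_mul_neg]
  rfl

end Recurrence

end LDQBD

theorem mainTheorem4 {α β : Type*} [Fintype α] [DecidableEq α] [Nonempty α]
    [Fintype β] [DecidableEq β] (D : LDQBD α β)
    (hgen : IsGenerator D.generator)
    (hirr : IsIrreducibleGenerator D.generator)
    (hrec : IsPositiveRecurrent D.generator)
    (x : α ⊕ ℕ × β → ℝ) (hx : IsStationaryProb D.generator x) :
    -- the tail probabilities are convergent sums, and `π (Q̂ - ℚ) = -(x_0 A_0^{(0)}, 0, 0, …)`
    (∀ i b, HasSum (fun j : ℕ => x (Sum.inr (i + j, b))) (LDQBD.tail x (i, b))) ∧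
    HasVecMul (LDQBD.tail x) (D.Qhat - D.shiftedQhat) (D.boundaryVec x) ∧
    -- every `Ψ_l` is an invertible (transient) generator
    (∀ l, (∀ a b, a ≠ b → 0 ≤ D.Psi l a b) ∧ (∀ a, ∑ b, D.Psi l a b ≤ 0) ∧
      IsUnit (D.Psi l) ∧ ∀ a b, 0 ≤ (-(D.Psi l)⁻¹) a b) ∧
    -- `(𝐑_k)` and `(𝐆_k)` are the unique nonnegative solutions of their equations
    (D.IsNonnegRSolution D.R ∧
      ∀ S, D.IsNonnegRSolution S → ∀ k, 1 ≤ k → S k = D.R k) ∧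
    (D.IsNonnegGSolution D.G ∧ ∀ S, D.IsNonnegGSolution S → S = D.G) ∧
    -- and are computed recursively
    (∀ k, 1 ≤ k → IsUnit (D.R k * D.A0 k + D.A1 (k + 1)) ∧
      D.R (k + 1) = -(D.A2 (k + 2) * (D.R k * D.A0 k + D.A1 (k + 1))⁻¹)) ∧
    (∀ k, 1 ≤ k → IsUnit (D.A1 (k + 1) + D.A2 (k + 1) * D.G (k - 1)) ∧
      D.G k = -((D.A1 (k + 1) + D.A2 (k + 1) * D.G (k - 1))⁻¹ * D.A0 (k + 1))) ∧
    -- the LU-type RG-factorization of `Q̂`, and the inverses of its factors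
    HasMatMul₃ (1 - D.RL) D.UD (1 - D.GU) D.Qhat ∧
    IsMatInverse (1 - D.RL) D.RLinv ∧
    IsMatInverse D.UD D.UDinv ∧
    IsMatInverse (1 - D.GU) D.GUinv ∧
    -- the maximal non-positive inverse `V` of `Q̂` exists, and
    ∃ V : Matrix (ℕ × β) (ℕ × β) ℝ, IsMaxNonposInverse D.Qhat V ∧
      -- `V = (I - 𝔾_U)⁻¹ 𝕌_D⁻¹ (I - ℝ_L)⁻¹`,
      HasMatMul₃ D.GUinv D.UDinv D.RLinv V ∧
      -- and, with `W = ℚ V`, `S = ∑_k W ^ k` and `u = -(x_0 A_0^{(0)}, 0, 0, …) V`,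
      -- one has `π (I - W) = u` and `π = u S`
      ∃ (W S : Matrix (ℕ × β) (ℕ × β) ℝ) (u : ℕ × β → ℝ),
        HasMatMul D.shiftedQhat V W ∧ HasPowerSum W S ∧
        HasVecMul (D.boundaryVec x) V u ∧
        HasVecMul (LDQBD.tail x) (1 - W) u ∧
        HasVecMul u S (LDQBD.tail x) := by
  have hu := LDQBD.isUnit_Psi hgen hirr
  have hs := LDQBD.summable_potentialTerm hgen hirr hx
  have hV := LDQBD.Qinv_isMaxNonposInverse hs hgen hirr
  refine ⟨fun i b => (LDQBD.summable_level hx i b).hasSum, LDQBD.tail_mul_Qhat_sub_shiftedQhat hx,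
    fun l => ⟨fun a b => LDQBD.Psi_offDiag_nonneg hgen hirr l,
      LDQBD.Psi_row_sum_nonpos hgen hirr l, hu l, LDQBD.N_nonneg hgen hirr l⟩,
    ⟨⟨fun k _ => LDQBD.R_nonneg hgen hirr k, rfl, LDQBD.R_equation hu⟩, fun S hS k hk => ?_⟩,
    ⟨⟨LDQBD.G_nonneg hgen hirr, rfl, LDQBD.G_equation hu⟩,
      fun S hS => funext (LDQBD.G_unique hu hS)⟩,
    fun k hk => ⟨?_, LDQBD.R_recursion k hk⟩, fun k hk => ⟨?_, LDQBD.G_recursion k hk⟩,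
    LDQBD.Qhat_factorization hu, D.RL_factor_inverse, LDQBD.UD_inverse hu, D.GU_factor_inverse,
    -- The placeholders become `W` the block shift, `S` the block lower triangular matrix of
    -- identities, and `u` the restriction of `x` to positive levels.
    D.Qinv, hV, LDQBD.Qinv_factorization hs hgen hirr, _, _, _,
    LDQBD.shiftedQhat_mul_inverse hV.1.1, LDQBD.hasPowerSum_shift,
    LDQBD.boundaryVec_mul_Qinv hgen hirr hrec hx, LDQBD.tail_mul_one_sub_shift hx,
    LDQBD.level_mul_lowerOnes hx⟩
  all_goals obtain ⟨k, rfl⟩ := Nat.exists_eq_add_of_le' hk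
  · exact LDQBD.R_unique hu hS k
  · rw [LDQBD.R_mul_A0_add]; exact hu _
  · rw [Nat.add_sub_cancel, LDQBD.A1_add_A2_mul_G]; exact hu _
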